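/- Let $m\ge 0$. Points of Minkowski space $\mathbb R^{1,3}=\mathbb R\times\mathbb R^3$ are written $x=(x^0,\vec x)$; put $x^2=-(x^0)^2+|\vec x|^2$ and $\Box=-\partial_0^2+\partial_1^2+\partial_2^2+\partial_3^2$. Let $J$ be the set of nonzero $x$ with $x^2\le 0$, and for $\mathcal O\subset\mathbb R^{1,3}$ let $J(\mathcal O)=\mathcal O+J$. Let $\mathcal Y_{\rm KG}$ be the space of real-valued $\zeta\in C^\infty(\mathbb R^{1,3})$ with $(-\Box+m^2)\zeta=0$ that are space-compact, i.e. $\operatorname{supp}\zeta\subset J(K)$ for some compact $K$. For $\zeta_1,\zeta_2\in\mathcal Y_{\rm KG}$ let $$\zeta_1\omega\zeta_2=\int_{\mathbb R^3}\bigl(-\partial_0\zeta_1(t,\vec x)\,\zeta_2(t,\vec x)+\zeta_1(t,\vec x)\,\partial_0\zeta_2(t,\vec x)\bigr)\,d\vec x,$$ which does not depend on $t\in\mathbb R$. Let $D$ be the Pauli–Jordan distribution $$D(x)=\int_{\mathbb R^3}\frac{d\vec k}{(2\pi)^3\,\varepsilon(\vec k)}\,e^{i\vec x\cdot\vec k}\sin\bigl(x^0\varepsilon(\vec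 k)\bigr),\qquad \varepsilon(\vec k)=\sqrt{|\vec k|^2+m^2},$$ i.e. $\int D(x)\varphi(x)\,dx=\int_{\mathbb R^3}\frac{d\vec k}{(2\pi)^3\varepsilon(\vec k)}\int_{\mathbb R^{1,3}} e^{i\vec x\cdot\vec k}\sin(x^0\varepsilon(\vec k))\,\varphi(x)\,dx$ for test functions $\varphi$, and let $(D*f)(x)=\int D(x-y)f(y)\,dy$ for $f\in C_c^\infty(\mathbb R^{1,3},\mathbb R)$. Then: 1. For every $f\in C_c^\infty(\mathbb R^{1,3},\mathbb R)$, the $\vec k$-integral defining $(D*f)(x)$ converges absolutely for every $x$, and $D*f\in\mathcal Y_{\rm KG}$. 2. Every element of $\mathcal Y_{\rm KG}$ is of the form $D*f$ with $f\in C_c^\infty(\mathbb R^{1,3},\mathbb R)$. 3. For all $f_1,f_2\in C_c^\infty(\mathbb R^{1,3},\mathbb R)$ and every choice of $t$ in the definition of $\omega$, $$-(D*f_1)\,\omega\,(D*f_2)=\iint f_1(x)D(x-y)f_2(y)\,dx\,dy=\int f_1(x)\,(D*f_2)(x)\,dx.$$ 4. If moreover the supports of $f_1,f_2$ are spatially separated,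 i.e. $J(\operatorname{supp}f_1)\cap\operatorname{supp}f_2=\emptyset$, then $(D*f_1)\,\omega\,(D*f_2)=0$. -/

import Mathlib

open MeasureTheory
open scoped ContDiff Pointwise RealInnerProductSpace

noncomputable section

namespace KleinGordon

/-- The spatial part `ℝ³` of Minkowski space. -/
abbrev Space : Type := EuclideanSpace ℝ (Fin 3)

/-- Minkowski space `ℝ^{1,3}`: a point is `x = (x⁰, x⃗)`. Its measure `volume` is Lebesgue
measure on `ℝ⁴`. -/
abbrev Minkowski : Type := ℝ × Space

/-- The quadratic form `x_μ x^μ = -(x⁰)² + |x⃗|²`. -/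
def minkowskiSq (x : Minkowski) : ℝ := -x.1 ^ 2 + ‖x.2‖ ^ 2

/-- The double cone `J = J⁺ ∪ J⁻` of all (by definition nonzero) causal vectors. -/
def causalCone : Set Minkowski := {x | x ≠ 0 ∧ minkowskiSq x ≤ 0}

/-- The causal shadow `J(O) = O + J`. -/
def causalShadow (O : Set Minkowski) : Set Minkowski := O + causalCone

/-- `O₁` and `O₂` are spatially separated: `J(O₁) ∩ O₂ = ∅`. -/
def SpatiallySeparated (O₁ O₂ : Set Minkowski) : Prop := causalShadow O₁ ∩ O₂ = ∅

/-- A function is space-compact if its support lies in `J(K)` for some compact `K`. -/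
def IsSpaceCompact (ζ : Minkowski → ℂ) : Prop :=
  ∃ K : Set Minkowski, IsCompact K ∧ tsupport ζ ⊆ causalShadow K

/-- The time derivative `∂₀ ζ`. -/
def timeDeriv (ζ : Minkowski → ℂ) (x : Minkowski) : ℂ :=
  fderiv ℝ ζ x ((1 : ℝ), (0 : Space))

/-- The spatial partial derivative `∂ᵢ ζ`. -/
def spaceDeriv (i : Fin 3) (ζ : Minkowski → ℂ) (x : Minkowski) : ℂ :=
  fderiv ℝ ζ x ((0 : ℝ), EuclideanSpace.single i (1 : ℝ))

/-- The d'Alembertian `□ = ∂_μ ∂^μ = -∂₀² + ∂₁² + ∂₂² + ∂₃²`. -/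
def box (ζ : Minkowski → ℂ) (x : Minkowski) : ℂ :=
  -timeDeriv (timeDeriv ζ) x + ∑ i : Fin 3, spaceDeriv i (spaceDeriv i ζ) x

/-- Smooth complex space-compact solutions of the Klein-Gordon equation `(-□ + m²) ζ = 0`. -/
def complexSolutions (m : ℝ) : Set (Minkowski → ℂ) :=
  {ζ | ContDiff ℝ ∞ ζ ∧ IsSpaceCompact ζ ∧ ∀ x, -box ζ x + (m : ℂ) ^ 2 * ζ x = 0}

/-- Smooth real space-compact solutions of the Klein-Gordon equation, that is, those complex
ones all of whose values are real. -/
def realSolutions (m : ℝ) : Set (Minkowski → ℂ) :=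
  {ζ | ζ ∈ complexSolutions m ∧ ∀ x, (ζ x).im = 0}

/-- The symplectic form `ζ₁ ω ζ₂ = ∫ (-∂₀ζ₁(t,x⃗) ζ₂(t,x⃗) + ζ₁(t,x⃗) ∂₀ζ₂(t,x⃗)) dx⃗`,
computed on the time slice `x⁰ = t`. -/
def symplecticForm (t : ℝ) (ζ₁ ζ₂ : Minkowski → ℂ) : ℂ :=
  ∫ x : Space, (-timeDeriv ζ₁ (t, x) * ζ₂ (t, x) + ζ₁ (t, x) * timeDeriv ζ₂ (t, x))

/-- Real-valued smooth compactly supported functions on Minkowski space. -/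
def IsTestFunction (f : Minkowski → ℝ) : Prop := ContDiff ℝ ∞ f ∧ HasCompactSupport f

/-- The energy `√(|k⃗|² + m²)` of a momentum `k⃗`. -/
def energy (m : ℝ) (k : Space) : ℝ := Real.sqrt (‖k‖ ^ 2 + m ^ 2)

/-- The contribution of the momentum `k⃗` to the pairing of the Pauli-Jordan distribution with
`φ`, namely
`(2π)⁻³ ε(k⃗)⁻¹ ∫ exp(i x⃗·k⃗) sin(x⁰ ε(k⃗)) φ(x) dx`, where `ε(k⃗) = √(|k⃗|² + m²)`. -/
def pauliJordanMode (m : ℝ) (φ : Minkowski → ℂ) (k : Space) : ℂ :=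
  (((2 * Real.pi) ^ 3 * energy m k : ℝ) : ℂ)⁻¹ *
    ∫ x : Minkowski,
      Complex.exp (Complex.I * ((⟪x.2, k⟫ : ℝ) : ℂ)) *
        ((Real.sin (x.1 * energy m k) : ℝ) : ℂ) * φ x

/-- The Pauli-Jordan function
`D(x) = ∫ exp(i x⃗·k⃗) sin(x⁰ ε(k⃗)) dk⃗ / ((2π)³ ε(k⃗))`, which is a distribution: its value
`∫ D(x) φ(x) dx` on a test function `φ`. -/
def pauliJordan (m : ℝ) (φ : Minkowski → ℂ) : ℂ :=
  ∫ k : Space, pauliJordanMode m φ k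

/-- The convolution `(D * f)(x) = ∫ D(x - y) f(y) dy = ∫ D(z) f(x - z) dz`. -/
def pauliJordanConv (m : ℝ) (f : Minkowski → ℝ) (x : Minkowski) : ℂ :=
  pauliJordan m (fun z => (f (x - z) : ℂ))

end KleinGordon

end

noncomputable section

namespace KleinGordon

open Filter Topology FourierTransform

/-! ### Plane waves and the propagators on the momentum side -/

/-! A Fourier transform in `x⃗` turns the Klein-Gordon equation into a family of oscillators with
frequency `ε(ξ)`. Their solutions are `S(t) A + C(t) B`, where `S = sin (tε) / ε`, `C = cos (tε)`,
and `A`, `B` are the velocity and the value at time `0`. Writing `S` with `sinc` avoids the division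
by `ε`, which vanishes at `ξ = 0` when `m = 0`.

The addition formula for `S (t - s)` separates the variables of `D(x - y)`, so `D * f` is such a
superposition (`pauliJordanConv_eq_modeSolution`). Its amplitudes are the transforms of `f` against
`C` and `-S`; they decay rapidly because `f` is smooth with compact support. Hence `D * f` is
smooth, and the equation reduces to the dispersion relation under the integral.

The support statement comes from the Duhamel form of `D * f`: an integral over `s` of the solutions
with value `0` and velocity `f(s, ·)` at time `s`. Each of them propagates with speed at most one
(`RealKleinGordon.eq_zero_of_initial`), because an energy weighted by a smooth function supported in
a light cone is nonincreasing up to the apex.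

For surjectivity let `χ` be a smooth function of time, `0` in the past and `1` in the future, and
take `f = (-□ + m²)(χ ζ) = χ'' ζ + 2 χ' ∂₀ζ`. It lives in `0 ≤ x⁰ ≤ 1`, where `ζ` has bounded
spatial support, so `f` has compact support. Variation of constants for each `ξ` gives `D * f = ζ`
(`integral_cutoff_oscillator`).

Finally, Parseval on a time slice and `C² + ε² S² = 1` reduce the symplectic form to a pairing of
the amplitudes `A`, `B` in which `t` has disappeared (`symplecticForm_modeSolution`). Fubini
identifies this pairing with `∫ f₁ (D * f₂)`. For separated supports the last integrand vanishes
pointwise by the support statement. -/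

/-- The plane wave `exp (2πi ξ·y)`. -/
def planeWave (y ξ : Space) : ℂ := Complex.exp (((2 * Real.pi * ⟪ξ, y⟫ : ℝ) : ℂ) * Complex.I)

/-- The frequency of the plane wave with momentum `2πξ`. -/
def freq (m : ℝ) (ξ : Space) : ℝ := energy m ((2 * Real.pi) • ξ)

/-- The solution `sin (tε) / ε` of the oscillator equation, continuous also at `ε = 0`. -/
def sinKernel (m t : ℝ) (ξ : Space) : ℝ := t * Real.sinc (t * freq m ξ)

/-- The solution `cos (tε)` of the oscillator equation. -/
def cosKernel (m t : ℝ) (ξ : Space) : ℝ := Real.cos (t * freq m ξ)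

lemma norm_planeWave (y ξ : Space) : ‖planeWave y ξ‖ = 1 :=
  Complex.norm_exp_ofReal_mul_I _

lemma planeWave_add (x y ξ : Space) : planeWave (x + y) ξ = planeWave x ξ * planeWave y ξ := by
  rw [planeWave, planeWave, planeWave, ← Complex.exp_add]
  congr 1
  rw [inner_add_right]
  push_cast
  ring

lemma planeWave_neg_right (x ξ : Space) : planeWave x (-ξ) = planeWave (-x) ξ := by
  simp [planeWave]

lemma conj_planeWave (x ξ : Space) : (starRingEnd ℂ) (planeWave x ξ) = planeWave (-x) ξ := by
  rw [planeWave, ← Complex.exp_conj, map_mul, Complex.conj_ofReal, Complex.conj_I, planeWave]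
  simp

@[fun_prop]
lemma continuous_planeWave : Continuous fun p : Space × Space => planeWave p.1 p.2 := by
  unfold planeWave
  fun_prop

@[fun_prop]
lemma continuous_freq (m : ℝ) : Continuous (freq m) := by
  unfold freq energy
  fun_prop

lemma freq_sq (m : ℝ) (ξ : Space) : freq m ξ ^ 2 = (2 * Real.pi) ^ 2 * ‖ξ‖ ^ 2 + m ^ 2 := by
  rw [freq, energy, Real.sq_sqrt (by positivity), norm_smul, mul_pow, Real.norm_eq_abs, sq_abs]

lemma freq_neg (m : ℝ) (ξ : Space) : freq m (-ξ) = freq m ξ := by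
  simp [freq, energy]

lemma sinKernel_neg_right (m t : ℝ) (ξ : Space) : sinKernel m t (-ξ) = sinKernel m t ξ := by
  simp [sinKernel, freq_neg]

lemma cosKernel_neg_right (m t : ℝ) (ξ : Space) : cosKernel m t (-ξ) = cosKernel m t ξ := by
  simp [cosKernel, freq_neg]

lemma sinKernel_neg_left (m t : ℝ) (ξ : Space) : sinKernel m (-t) ξ = -sinKernel m t ξ := by
  simp [sinKernel]

lemma sinKernel_zero_left (m : ℝ) (ξ : Space) : sinKernel m 0 ξ = 0 := by
  simp [sinKernel]

lemma cosKernel_zero_left (m : ℝ) (ξ : Space) : cosKernel m 0 ξ = 1 := by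
  simp [cosKernel]

@[fun_prop]
lemma continuous_sinKernel (m : ℝ) :
    Continuous fun p : ℝ × Space => sinKernel m p.1 p.2 := by
  unfold sinKernel
  have := Real.continuous_sinc
  fun_prop

@[fun_prop]
lemma continuous_cosKernel (m : ℝ) :
    Continuous fun p : ℝ × Space => cosKernel m p.1 p.2 := by
  unfold cosKernel
  fun_prop

lemma abs_sinKernel_le (m t : ℝ) (ξ : Space) : |sinKernel m t ξ| ≤ |t| := by
  rw [sinKernel, abs_mul]
  exact mul_le_of_le_one_right (abs_nonneg _) (Real.abs_sinc_le_one _)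

lemma abs_cosKernel_le (m t : ℝ) (ξ : Space) : |cosKernel m t ξ| ≤ 1 := Real.abs_cos_le_one _

lemma freq_mul_sinKernel (m t : ℝ) (ξ : Space) :
    freq m ξ * sinKernel m t ξ = Real.sin (t * freq m ξ) := by
  by_cases h : t * freq m ξ = 0
  · rw [h, Real.sin_zero, sinKernel, ← mul_assoc, mul_comm (freq m ξ), h, zero_mul]
  · rw [sinKernel, Real.sinc_of_ne_zero h]
    field_simp [(mul_ne_zero_iff.1 h).1, (mul_ne_zero_iff.1 h).2]

lemma cosKernel_sq_add (m t : ℝ) (ξ : Space) :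
    cosKernel m t ξ ^ 2 + freq m ξ ^ 2 * sinKernel m t ξ ^ 2 = 1 := by
  rw [← mul_pow, freq_mul_sinKernel, cosKernel, Real.cos_sq_add_sin_sq]

/-- The addition formula of the sine divided by `ε`; for `ε = 0` it reads `t - s = t - s`. It is
what splits `D(x - y)` into functions of `x` and of `y`. -/
lemma sinKernel_sub (m t s : ℝ) (ξ : Space) :
    sinKernel m (t - s) ξ =
      sinKernel m t ξ * cosKernel m s ξ - cosKernel m t ξ * sinKernel m s ξ := by
  by_cases h : freq m ξ = 0
  · simp [sinKernel, cosKernel, h]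
  · apply mul_left_cancel₀ h
    rw [mul_sub, ← mul_assoc, freq_mul_sinKernel, mul_left_comm, freq_mul_sinKernel,
      freq_mul_sinKernel, sub_mul, Real.sin_sub, cosKernel, cosKernel]

lemma hasDerivAt_sinKernel (m t : ℝ) (ξ : Space) :
    HasDerivAt (fun t => sinKernel m t ξ) (cosKernel m t ξ) t := by
  by_cases h : freq m ξ = 0
  · simp only [sinKernel, cosKernel, h, mul_zero, Real.sinc_zero, mul_one, Real.cos_zero]
    exact hasDerivAt_id t
  · have h1 : (fun t => sinKernel m t ξ) = fun t => Real.sin (t * freq m ξ) / freq m ξ := by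
      funext t
      rw [← freq_mul_sinKernel, mul_div_cancel_left₀ _ h]
    rw [h1]
    convert! (((hasDerivAt_id t).mul_const (freq m ξ)).sin).div_const (freq m ξ) using 1
    simp [cosKernel, h]

lemma hasDerivAt_cosKernel (m t : ℝ) (ξ : Space) :
    HasDerivAt (fun t => cosKernel m t ξ) (-(freq m ξ ^ 2 * sinKernel m t ξ)) t := by
  convert! ((hasDerivAt_id t).mul_const (freq m ξ)).cos using 1
  rw [pow_two, mul_assoc, freq_mul_sinKernel]
  simp
  ring

/-! ### Rapidly decaying amplitudes -/

/-- Continuous functions on momentum space that decay faster than any power. -/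
def RapidDecay (a : Space → ℂ) : Prop :=
  Continuous a ∧ ∀ n : ℕ, ∃ C : ℝ, ∀ ξ, ‖ξ‖ ^ n * ‖a ξ‖ ≤ C

lemma RapidDecay.continuous {a : Space → ℂ} (ha : RapidDecay a) : Continuous a := ha.1

lemma RapidDecay.integrable {a : Space → ℂ} (ha : RapidDecay a) : Integrable a := by
  obtain ⟨C₁, h₁⟩ := ha.2 0
  obtain ⟨C₂, h₂⟩ := ha.2 (0 + (volume : Measure Space).integrablePower)
  have := integrable_of_le_of_pow_mul_le (μ := (volume : Measure Space)) (k := 0)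
    (fun ξ => by simpa using h₁ ξ) h₂ ha.1.aestronglyMeasurable
  rw [← integrable_norm_iff ha.1.aestronglyMeasurable]
  simpa using this

lemma RapidDecay.zero : RapidDecay 0 := ⟨continuous_zero, fun n => ⟨0, by simp⟩⟩

/-- A factor of polynomial growth only costs `k` powers of `‖ξ‖`, and all powers are available.
Derivatives multiply amplitudes by such factors. -/
lemma RapidDecay.mul_growth {a : Space → ℂ} (ha : RapidDecay a) {g : Space → ℂ}
    (hg : Continuous g) {C : ℝ} {k : ℕ} (hC : ∀ ξ, ‖g ξ‖ ≤ C * (1 + ‖ξ‖ ^ k)) :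
    RapidDecay fun ξ => g ξ * a ξ := by
  refine ⟨hg.mul ha.1, fun n => ?_⟩
  obtain ⟨C₁, h₁⟩ := ha.2 n
  obtain ⟨C₂, h₂⟩ := ha.2 (n + k)
  have hC0 : 0 ≤ C := by
    have := (norm_nonneg _).trans (hC 0)
    have h : 0 < 1 + ‖(0 : Space)‖ ^ k := by positivity
    exact nonneg_of_mul_nonneg_left this h
  refine ⟨C * (C₁ + C₂), fun ξ => ?_⟩
  calc ‖ξ‖ ^ n * ‖g ξ * a ξ‖ = ‖g ξ‖ * (‖ξ‖ ^ n * ‖a ξ‖) := by rw [norm_mul]; ring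
    _ ≤ C * (1 + ‖ξ‖ ^ k) * (‖ξ‖ ^ n * ‖a ξ‖) :=
        mul_le_mul_of_nonneg_right (hC ξ) (by positivity)
    _ = C * (‖ξ‖ ^ n * ‖a ξ‖ + ‖ξ‖ ^ (n + k) * ‖a ξ‖) := by rw [pow_add]; ring
    _ ≤ C * (C₁ + C₂) := mul_le_mul_of_nonneg_left (add_le_add (h₁ ξ) (h₂ ξ)) hC0

lemma RapidDecay.mul_bounded {a : Space → ℂ} (ha : RapidDecay a) {g : Space → ℂ}
    (hg : Continuous g) {C : ℝ} (hC : ∀ ξ, ‖g ξ‖ ≤ C) : RapidDecay fun ξ => g ξ * a ξ := by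
  refine ha.mul_growth hg (C := C) (k := 0) fun ξ => (hC ξ).trans ?_
  have := (norm_nonneg _).trans (hC 0)
  rw [pow_zero]
  linarith

lemma RapidDecay.add {a b : Space → ℂ} (ha : RapidDecay a) (hb : RapidDecay b) :
    RapidDecay fun ξ => a ξ + b ξ := by
  refine ⟨ha.1.add hb.1, fun n => ?_⟩
  obtain ⟨C₁, h₁⟩ := ha.2 n
  obtain ⟨C₂, h₂⟩ := hb.2 n
  refine ⟨C₁ + C₂, fun ξ => (mul_le_mul_of_nonneg_left (norm_add_le _ _) (by positivity)).trans ?_⟩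
  rw [mul_add]
  exact add_le_add (h₁ ξ) (h₂ ξ)

lemma RapidDecay.neg {a : Space → ℂ} (ha : RapidDecay a) : RapidDecay fun ξ => -a ξ :=
  ⟨ha.1.neg, fun n => by simpa using ha.2 n⟩

lemma RapidDecay.freq_sq_mul {a : Space → ℂ} (ha : RapidDecay a) (m : ℝ) :
    RapidDecay fun ξ => (freq m ξ : ℂ) ^ 2 * a ξ := by
  refine ha.mul_growth (by fun_prop) (C := (2 * Real.pi) ^ 2 + m ^ 2) (k := 2) fun ξ => ?_
  rw [norm_pow, Complex.norm_real, Real.norm_eq_abs, sq_abs, freq_sq]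
  nlinarith [mul_nonneg (sq_nonneg m) (sq_nonneg ‖ξ‖), sq_nonneg (2 * Real.pi)]

lemma RapidDecay.coord_mul {a : Space → ℂ} (ha : RapidDecay a) (i : Fin 3) :
    RapidDecay fun ξ => (2 * Real.pi * Complex.I * (ξ i : ℂ)) * a ξ := by
  refine ha.mul_growth (by fun_prop) (C := 2 * Real.pi) (k := 1) fun ξ => ?_
  have h : |ξ i| ≤ ‖ξ‖ := by simpa using PiLp.norm_apply_le ξ i
  simp only [norm_mul, Complex.norm_real, Complex.norm_I, Complex.norm_ofNat, Real.norm_eq_abs,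
    abs_of_pos Real.pi_pos, mul_one, pow_one]
  have := Real.pi_pos
  nlinarith

/-- The amplitude at time `t` of the mode with velocity `A` and value `B` at time `0`. -/
def amplitude (m : ℝ) (A B : Space → ℂ) (t : ℝ) (ξ : Space) : ℂ :=
  (sinKernel m t ξ : ℂ) * A ξ + (cosKernel m t ξ : ℂ) * B ξ

lemma RapidDecay.amplitude {A B : Space → ℂ} (hA : RapidDecay A) (hB : RapidDecay B) (m t : ℝ) :
    RapidDecay (amplitude m A B t) := by
  refine RapidDecay.add (hA.mul_bounded (by fun_prop) (C := |t|) fun ξ => ?_)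
    (hB.mul_bounded (by fun_prop) (C := 1) fun ξ => ?_)
  · simpa using abs_sinKernel_le m t ξ
  · simpa using abs_cosKernel_le m t ξ

lemma norm_amplitude_le (m : ℝ) (A B : Space → ℂ) (t : ℝ) (ξ : Space) :
    ‖amplitude m A B t ξ‖ ≤ |t| * ‖A ξ‖ + ‖B ξ‖ := by
  refine (norm_add_le _ _).trans (add_le_add ?_ ?_)
  · rw [norm_mul, Complex.norm_real]
    exact mul_le_mul_of_nonneg_right (abs_sinKernel_le m t ξ) (norm_nonneg _)
  · rw [norm_mul, Complex.norm_real]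
    exact mul_le_of_le_one_left (norm_nonneg _) (abs_cosKernel_le m t ξ)

/-! ### Solutions given by amplitudes -/

/-- The superposition of the plane waves with amplitudes `amplitude m A B`. -/
def modeSolution (m : ℝ) (A B : Space → ℂ) (x : Minkowski) : ℂ :=
  ∫ ξ, planeWave x.2 ξ * amplitude m A B x.1 ξ

/-- The `i`-th spatial coordinate on Minkowski space. -/
def spaceCoord (i : Fin 3) : Minkowski →L[ℝ] ℝ :=
  (EuclideanSpace.proj i : Space →L[ℝ] ℝ).comp (ContinuousLinearMap.snd ℝ ℝ Space)

lemma hasFDerivAt_planeWave (x : Minkowski) (ξ : Space) :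
    HasFDerivAt (fun x : Minkowski => planeWave x.2 ξ)
      (∑ i, (spaceCoord i).smulRight (planeWave x.2 ξ * (2 * Real.pi * Complex.I * (ξ i : ℂ)))) x := by
  have h1 : HasFDerivAt (fun x : Minkowski => (2 * Real.pi * ⟪ξ, x.2⟫ : ℝ))
      ((2 * Real.pi) • (innerSL ℝ ξ).comp (ContinuousLinearMap.snd ℝ ℝ Space)) x :=
    (((innerSL ℝ ξ).comp (ContinuousLinearMap.snd ℝ ℝ Space)).hasFDerivAt).const_mul _
  have h2 := ((Complex.ofRealCLM.hasFDerivAt.comp x h1).mul_const Complex.I).cexp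
  refine h2.congr_fderiv ?_
  ext v
  · simp [spaceCoord]
  · simp [spaceCoord, planeWave, PiLp.inner_apply, Fin.sum_univ_three]
    ring

/-- The momentum amplitude of the `i`-th spatial derivative. -/
def coordMul (i : Fin 3) (A : Space → ℂ) (ξ : Space) : ℂ :=
  (2 * Real.pi * Complex.I * (ξ i : ℂ)) * A ξ

/-- The amplitude `-ε² A`. -/
def negFreqSqMul (m : ℝ) (A : Space → ℂ) (ξ : Space) : ℂ := -((freq m ξ : ℂ) ^ 2 * A ξ)

lemma RapidDecay.coordMul {A : Space → ℂ} (hA : RapidDecay A) (i : Fin 3) :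
    RapidDecay (coordMul i A) := hA.coord_mul i

lemma RapidDecay.negFreqSqMul {A : Space → ℂ} (hA : RapidDecay A) (m : ℝ) :
    RapidDecay (negFreqSqMul m A) := (hA.freq_sq_mul m).neg

/-- Since `S' = C` and `C' = -ε² S`, a time derivative sends the pair (velocity, value) from `(A,
B)` to `(-ε² B, A)`. The derivative is thus again of the same form. -/
lemma hasDerivAt_amplitude (m : ℝ) (A B : Space → ℂ) (t : ℝ) (ξ : Space) :
    HasDerivAt (fun t => amplitude m A B t ξ) (amplitude m (negFreqSqMul m B) A t ξ) t := by
  have h1 := ((hasDerivAt_sinKernel m t ξ).ofReal_comp.mul_const (A ξ)).add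
    ((hasDerivAt_cosKernel m t ξ).ofReal_comp.mul_const (B ξ))
  refine h1.congr_deriv ?_
  simp only [amplitude, negFreqSqMul]
  push_cast
  ring

/-- The integrand of `modeSolution`. -/
def mode (m : ℝ) (A B : Space → ℂ) (x : Minkowski) (ξ : Space) : ℂ :=
  planeWave x.2 ξ * amplitude m A B x.1 ξ

/-- The spacetime derivative of `mode`. -/
def modeDeriv (m : ℝ) (A B : Space → ℂ) (x : Minkowski) (ξ : Space) : Minkowski →L[ℝ] ℂ :=
  (ContinuousLinearMap.fst ℝ ℝ Space).smulRight (mode m (negFreqSqMul m B) A x ξ) +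
    ∑ i, (spaceCoord i).smulRight (mode m (coordMul i A) (coordMul i B) x ξ)

lemma hasFDerivAt_mode (m : ℝ) (A B : Space → ℂ) (x : Minkowski) (ξ : Space) :
    HasFDerivAt (fun x : Minkowski => mode m A B x ξ) (modeDeriv m A B x ξ) x := by
  have h1 : HasFDerivAt (fun x : Minkowski => amplitude m A B x.1 ξ) _ x :=
    (hasDerivAt_amplitude m A B x.1 ξ).hasFDerivAt.comp x
      (ContinuousLinearMap.fst ℝ ℝ Space).hasFDerivAt
  refine ((hasFDerivAt_planeWave x ξ).mul h1).congr_fderiv ?_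
  ext v
  · simp [spaceCoord, amplitude, modeDeriv, mode]
  · simp [spaceCoord, amplitude, modeDeriv, mode, Fin.sum_univ_three, coordMul]
    ring

lemma norm_fst_smulRight_le (z : ℂ) :
    ‖(ContinuousLinearMap.fst ℝ ℝ Space).smulRight z‖ ≤ ‖z‖ := by
  rw [ContinuousLinearMap.norm_smulRight_apply]
  exact mul_le_of_le_one_left (norm_nonneg _) (ContinuousLinearMap.norm_fst_le ..)

lemma norm_spaceCoord_smulRight_le (i : Fin 3) (z : ℂ) :
    ‖(spaceCoord i).smulRight z‖ ≤ ‖z‖ := by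
  rw [ContinuousLinearMap.norm_smulRight_apply]
  refine mul_le_of_le_one_left (norm_nonneg _) ?_
  refine ContinuousLinearMap.opNorm_le_bound _ zero_le_one fun v => ?_
  rw [one_mul]
  exact (PiLp.norm_apply_le v.2 i).trans (norm_snd_le v)

lemma norm_mode_le (m : ℝ) (A B : Space → ℂ) (x : Minkowski) (ξ : Space) :
    ‖mode m A B x ξ‖ ≤ |x.1| * ‖A ξ‖ + ‖B ξ‖ := by
  rw [mode, norm_mul, norm_planeWave, one_mul]
  exact norm_amplitude_le m A B x.1 ξ

lemma norm_modeDeriv_le (m : ℝ) (A B : Space → ℂ) (x : Minkowski) (ξ : Space) {T : ℝ}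
    (hT : |x.1| ≤ T) :
    ‖modeDeriv m A B x ξ‖ ≤ (T * ‖negFreqSqMul m B ξ‖ + ‖A ξ‖) +
      ∑ i : Fin 3, (T * ‖coordMul i A ξ‖ + ‖coordMul i B ξ‖) := by
  have hmode : ∀ A B : Space → ℂ, ‖mode m A B x ξ‖ ≤ T * ‖A ξ‖ + ‖B ξ‖ := fun A B =>
    (norm_mode_le m A B x ξ).trans (by gcongr)
  refine (norm_add_le _ _).trans (add_le_add ((norm_fst_smulRight_le _).trans (hmode _ _)) ?_)
  exact (norm_sum_le _ _).trans (Finset.sum_le_sum fun i _ =>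
    (norm_spaceCoord_smulRight_le i _).trans (hmode _ _))

lemma integrable_mode {A B : Space → ℂ} (hA : RapidDecay A) (hB : RapidDecay B) (m : ℝ)
    (x : Minkowski) : Integrable (mode m A B x) := by
  have hc : Continuous fun ξ => planeWave x.2 ξ := by fun_prop
  exact ((hA.amplitude hB m x.1).mul_bounded hc (C := 1)
    fun ξ => (norm_planeWave _ _).le).integrable

lemma integrable_smulRight (c : Minkowski →L[ℝ] ℝ) {f : Space → ℂ} (hf : Integrable f) :
    Integrable fun ξ => c.smulRight (f ξ) :=
  (ContinuousLinearMap.smulRightL ℝ Minkowski ℂ c).integrable_comp hf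

lemma integral_smulRight_const (c : Minkowski →L[ℝ] ℝ) {f : Space → ℂ} (hf : Integrable f) :
    ∫ ξ, c.smulRight (f ξ) = c.smulRight (∫ ξ, f ξ) :=
  ContinuousLinearMap.integral_comp_comm (ContinuousLinearMap.smulRightL ℝ Minkowski ℂ c) hf

lemma _root_.MeasureTheory.Integrable.add_normed {E : Type*} [NormedAddCommGroup E]
    {f g : Space → E} (hf : Integrable f) (hg : Integrable g) : Integrable fun x => f x + g x :=
  hf.add hg

lemma integrable_modeDeriv {A B : Space → ℂ} (hA : RapidDecay A) (hB : RapidDecay B) (m : ℝ)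
    (x : Minkowski) : Integrable (modeDeriv m A B x) := by
  have h1 := integrable_smulRight (ContinuousLinearMap.fst ℝ ℝ Space)
    (integrable_mode (hB.negFreqSqMul m) hA m x)
  have h2 : ∀ i, Integrable fun ξ =>
      (spaceCoord i).smulRight (mode m (coordMul i A) (coordMul i B) x ξ) := fun i =>
    integrable_smulRight _ (integrable_mode (hA.coordMul i) (hB.coordMul i) m x)
  unfold modeDeriv
  simp only [Fin.sum_univ_three]
  exact h1.add_normed (((h2 0).add_normed (h2 1)).add_normed (h2 2))

lemma integral_modeDeriv {A B : Space → ℂ} (hA : RapidDecay A) (hB : RapidDecay B) (m : ℝ)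
    (x : Minkowski) :
    ∫ ξ, modeDeriv m A B x ξ =
      (ContinuousLinearMap.fst ℝ ℝ Space).smulRight (modeSolution m (negFreqSqMul m B) A x) +
        ∑ i, (spaceCoord i).smulRight (modeSolution m (coordMul i A) (coordMul i B) x) := by
  have hi := fun i : Fin 3 => integrable_mode (hA.coordMul i) (hB.coordMul i) m x
  have ht := integrable_mode (hB.negFreqSqMul m) hA m x
  unfold modeDeriv
  rw [integral_add (integrable_smulRight _ ht)
      (integrable_finsetSum Finset.univ fun i _ => integrable_smulRight _ (hi i)),
    integral_finsetSum Finset.univ fun i _ => integrable_smulRight _ (hi i),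
    integral_smulRight_const _ ht]
  congr 1
  exact Finset.sum_congr rfl fun i _ => integral_smulRight_const (spaceCoord i) (hi i)

/-- Differentiation under the integral. On the unit ball around `x` the time is at most `|x⁰| + 1`
in absolute value, which bounds the integrand's derivative by a fixed combination of rapidly
decaying amplitudes. -/
lemma hasFDerivAt_modeSolution {A B : Space → ℂ} (hA : RapidDecay A) (hB : RapidDecay B) (m : ℝ)
    (x : Minkowski) :
    HasFDerivAt (modeSolution m A B)
      ((ContinuousLinearMap.fst ℝ ℝ Space).smulRight (modeSolution m (negFreqSqMul m B) A x) +
        ∑ i, (spaceCoord i).smulRight (modeSolution m (coordMul i A) (coordMul i B) x)) x := by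
  rw [← integral_modeDeriv hA hB m x]
  refine hasFDerivAt_integral_of_dominated_of_fderiv_le (μ := (volume : Measure Space))
    (F := mode m A B) (Metric.ball_mem_nhds x one_pos)
    (bound := fun ξ => ((|x.1| + 1) * ‖negFreqSqMul m B ξ‖ + ‖A ξ‖) +
      ∑ i : Fin 3, ((|x.1| + 1) * ‖coordMul i A ξ‖ + ‖coordMul i B ξ‖))
    (Eventually.of_forall fun y => (integrable_mode hA hB m y).aestronglyMeasurable)
    (integrable_mode hA hB m x) (integrable_modeDeriv hA hB m x).aestronglyMeasurable ?_ ?_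
    (Eventually.of_forall fun ξ y _ => hasFDerivAt_mode m A B y ξ)
  · refine Eventually.of_forall fun ξ y hy => norm_modeDeriv_le m A B y ξ ?_
    have h2 : ‖(y - x).1‖ ≤ ‖y - x‖ := norm_fst_le _
    have h3 : ‖y - x‖ < 1 := by simpa [dist_eq_norm] using hy
    rw [Prod.fst_sub, Real.norm_eq_abs] at h2
    have h4 := abs_sub_abs_le_abs_sub y.1 x.1
    linarith
  · exact (((hB.negFreqSqMul m).integrable.norm.const_mul _).add hA.integrable.norm).add
      (integrable_finsetSum Finset.univ fun i _ => ((hA.coordMul i).integrable.norm.const_mul _).add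
        (hB.coordMul i).integrable.norm)

/-- The components of the derivative are again mode solutions with rapidly decaying amplitudes, so
the order of differentiability can be raised by induction over all amplitudes at once. -/
lemma contDiff_modeSolution {A B : Space → ℂ} (hA : RapidDecay A) (hB : RapidDecay B) (m : ℝ) :
    ContDiff ℝ ∞ (modeSolution m A B) := by
  refine contDiff_infty.2 fun n => ?_
  induction n generalizing A B with
  | zero =>
    exact contDiff_zero.2 (continuous_iff_continuousAt.2 fun x =>
      (hasFDerivAt_modeSolution hA hB m x).continuousAt)
  | succ n ih =>
    push_cast
    refine contDiff_succ_iff_hasFDerivAt.2 ⟨_, ?_, hasFDerivAt_modeSolution hA hB m⟩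
    refine ContDiff.add ?_ (ContDiff.sum fun i _ => ?_)
    · exact contDiff_const.smulRight (ih (hB.negFreqSqMul m) hA)
    · exact contDiff_const.smulRight (ih (hA.coordMul i) (hB.coordMul i))

lemma timeDeriv_modeSolution {A B : Space → ℂ} (hA : RapidDecay A) (hB : RapidDecay B) (m : ℝ) :
    timeDeriv (modeSolution m A B) = modeSolution m (negFreqSqMul m B) A := by
  funext x
  rw [timeDeriv, (hasFDerivAt_modeSolution hA hB m x).fderiv]
  simp [spaceCoord]

lemma spaceDeriv_modeSolution {A B : Space → ℂ} (hA : RapidDecay A) (hB : RapidDecay B) (m : ℝ)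
    (i : Fin 3) :
    spaceDeriv i (modeSolution m A B) = modeSolution m (coordMul i A) (coordMul i B) := by
  funext x
  rw [spaceDeriv, (hasFDerivAt_modeSolution hA hB m x).fderiv]
  simp [spaceCoord]

lemma modeSolution_kleinGordon {A B : Space → ℂ} (hA : RapidDecay A) (hB : RapidDecay B) (m : ℝ)
    (x : Minkowski) :
    -box (modeSolution m A B) x + (m : ℂ) ^ 2 * modeSolution m A B x = 0 := by
  have ht := integrable_mode (hA.negFreqSqMul m) (hB.negFreqSqMul m) m x
  have hi := fun i : Fin 3 =>
    integrable_mode ((hA.coordMul i).coordMul i) ((hB.coordMul i).coordMul i) m x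
  have hs : ∀ i, spaceDeriv i (spaceDeriv i (modeSolution m A B)) = _ := fun i => by
    rw [spaceDeriv_modeSolution hA hB, spaceDeriv_modeSolution (hA.coordMul i) (hB.coordMul i)]
  rw [box, timeDeriv_modeSolution hA hB, timeDeriv_modeSolution (hB.negFreqSqMul m) hA]
  simp only [hs]
  change -(-(∫ ξ, mode m _ _ x ξ) + ∑ i, ∫ ξ, mode m _ _ x ξ) + _ * ∫ ξ, mode m A B x ξ = 0
  rw [← integral_finsetSum Finset.univ fun i _ => hi i, ← integral_neg,
    ← integral_add ht.fun_neg (integrable_finsetSum Finset.univ fun i _ => hi i), ← integral_neg,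
    ← integral_const_mul, ← integral_add
      (ht.fun_neg.fun_add (integrable_finsetSum Finset.univ fun i _ => hi i)).fun_neg
      ((integrable_mode hA hB m x).const_mul _), ← integral_zero Space ℂ]
  congr 1
  funext ξ
  -- The dispersion relation `ε² = 4π² |ξ|² + m²`; with it the integrand vanishes for each `ξ`.
  have h2 : (freq m ξ : ℂ) ^ 2 =
      (2 * Real.pi) ^ 2 * ((ξ 0 : ℂ) ^ 2 + (ξ 1 : ℂ) ^ 2 + (ξ 2 : ℂ) ^ 2) + (m : ℂ) ^ 2 := by
    rw [← Complex.ofReal_pow, freq_sq, EuclideanSpace.norm_sq_eq, Fin.sum_univ_three]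
    simp
  simp only [mode, amplitude, coordMul, negFreqSqMul, Fin.sum_univ_three, h2]
  linear_combination (-planeWave x.2 ξ * 4 * Real.pi ^ 2 *
    ((ξ 0 : ℂ) ^ 2 + (ξ 1 : ℂ) ^ 2 + (ξ 2 : ℂ) ^ 2) *
    (sinKernel m x.1 ξ * A ξ + cosKernel m x.1 ξ * B ξ)) * Complex.I_sq

lemma modeSolution_eq_fourierInv (m : ℝ) (A B : Space → ℂ) (x : Minkowski) :
    modeSolution m A B x = 𝓕⁻ (amplitude m A B x.1) x.2 := by
  rw [Real.fourierInv_eq']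
  rfl

/-! ### The oscillatory transforms of test functions -/

instance : (volume : Measure Minkowski).IsAddHaarMeasure :=
  inferInstanceAs ((volume : Measure ℝ).prod (volume : Measure Space)).IsAddHaarMeasure

/-- The pairing of `g` with the Klein-Gordon mode of momentum `-2πξ` that at time `0` has velocity
`a` and value `b`. -/
def modeTransform (m : ℝ) (a b : ℂ) (g : Minkowski → ℂ) (ξ : Space) : ℂ :=
  ∫ z, mode m (fun _ => a) (fun _ => b) z (-ξ) * g z

lemma continuous_mode_const (m : ℝ) (a b : ℂ) :
    Continuous fun p : Minkowski × Space => mode m (fun _ => a) (fun _ => b) p.1 p.2 := by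
  unfold mode amplitude
  fun_prop

lemma integrable_mode_mul (m : ℝ) (a b : ℂ) {g : Minkowski → ℂ} (hg : Continuous g)
    (hc : HasCompactSupport g) (ξ : Space) :
    Integrable fun z => mode m (fun _ => a) (fun _ => b) z ξ * g z := by
  have h := continuous_mode_const m a b
  exact Continuous.integrable_of_hasCompactSupport (by fun_prop) hc.mul_left

lemma continuous_modeTransform (m : ℝ) (a b : ℂ) {g : Minkowski → ℂ} (hg : Continuous g)
    (hc : HasCompactSupport g) : Continuous (modeTransform m a b g) := by
  have h := continuous_mode_const m a b
  have h1 : modeTransform m a b g =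
      fun ξ => ∫ z in tsupport g, mode m (fun _ => a) (fun _ => b) z (-ξ) * g z := by
    funext ξ
    exact (setIntegral_eq_integral_of_forall_compl_eq_zero fun z hz => by
      rw [image_eq_zero_of_notMem_tsupport hz, mul_zero]).symm
  rw [h1]
  exact continuous_parametric_integral_of_continuous (by fun_prop) hc.isCompact

lemma norm_modeTransform_le (m : ℝ) (a b : ℂ) {g : Minkowski → ℂ} (hg : Continuous g)
    (hc : HasCompactSupport g) (ξ : Space) :
    ‖modeTransform m a b g ξ‖ ≤ ∫ z, (|z.1| * ‖a‖ + ‖b‖) * ‖g z‖ := by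
  refine norm_integral_le_of_norm_le ?_ (Eventually.of_forall fun z => ?_)
  · exact Continuous.integrable_of_hasCompactSupport (by fun_prop) hc.norm.mul_left
  · rw [norm_mul]
    exact mul_le_mul_of_nonneg_right (norm_mode_le _ _ _ _ _) (norm_nonneg _)

lemma continuous_spaceDeriv {g : Minkowski → ℂ} (hg : ContDiff ℝ ∞ g) (i : Fin 3) :
    Continuous (spaceDeriv i g) :=
  (hg.continuous_fderiv (by simp)).clm_apply continuous_const

lemma contDiff_spaceDeriv {g : Minkowski → ℂ} (hg : ContDiff ℝ ∞ g) (i : Fin 3) :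
    ContDiff ℝ ∞ (spaceDeriv i g) :=
  (hg.fderiv_right (by simp)).clm_apply contDiff_const

lemma contDiff_timeDeriv {g : Minkowski → ℂ} (hg : ContDiff ℝ ∞ g) :
    ContDiff ℝ ∞ (timeDeriv g) :=
  (hg.fderiv_right (by simp)).clm_apply contDiff_const

lemma hasCompactSupport_spaceDeriv {g : Minkowski → ℂ} (hc : HasCompactSupport g) (i : Fin 3) :
    HasCompactSupport (spaceDeriv i g) :=
  hc.fderiv_apply (𝕜 := ℝ) _

/-- Integration by parts. Its minus sign cancels the one from the momentum `-2πξ` of the mode. -/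
lemma modeTransform_spaceDeriv (m : ℝ) (a b : ℂ) {g : Minkowski → ℂ} (hg : ContDiff ℝ ∞ g)
    (hc : HasCompactSupport g) (i : Fin 3) (ξ : Space) :
    modeTransform m a b (spaceDeriv i g) ξ = coordMul i (modeTransform m a b g) ξ := by
  set G : Minkowski → ℂ := fun z => mode m (fun _ => a) (fun _ => b) z (-ξ) with hG
  have hd : ∀ z, fderiv ℝ G z ((0 : ℝ), EuclideanSpace.single i (1 : ℝ)) =
      -(2 * Real.pi * Complex.I * (ξ i : ℂ)) * G z := fun z => by
    rw [hG, (hasFDerivAt_mode _ _ _ z (-ξ)).fderiv]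
    simp [modeDeriv, spaceCoord, mode, amplitude, coordMul]
    ring
  have h := integral_mul_fderiv_eq_neg_fderiv_mul_of_integrable (μ := (volume : Measure Minkowski))
    (f := G) (g := g) (v := ((0 : ℝ), EuclideanSpace.single i (1 : ℝ))) ?_ ?_ ?_
    (fun z _ => (hasFDerivAt_mode _ _ _ z (-ξ)).differentiableAt)
    (fun z _ => (hg.differentiable (by simp)) z)
  · rw [coordMul, modeTransform, modeTransform]
    refine h.trans ?_
    rw [← integral_neg, ← integral_const_mul]
    congr 1
    funext z
    rw [hd]
    ring
  · simp only [hd, mul_assoc]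
    exact (integrable_mode_mul m a b hg.continuous hc (-ξ)).const_mul _
  · exact integrable_mode_mul m a b (continuous_spaceDeriv hg i)
      (hasCompactSupport_spaceDeriv hc i) (-ξ)
  · exact integrable_mode_mul m a b hg.continuous hc (-ξ)

lemma norm_le_sum_abs (ξ : Space) : ‖ξ‖ ≤ ∑ i, |ξ i| := by
  refine le_of_sq_le_sq ?_ (Finset.sum_nonneg fun i _ => abs_nonneg _)
  rw [EuclideanSpace.norm_sq_eq, Fin.sum_univ_three, Fin.sum_univ_three]
  simp only [Real.norm_eq_abs]
  nlinarith [abs_nonneg (ξ 0), abs_nonneg (ξ 1), abs_nonneg (ξ 2),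
    mul_nonneg (abs_nonneg (ξ 0)) (abs_nonneg (ξ 1)),
    mul_nonneg (abs_nonneg (ξ 0)) (abs_nonneg (ξ 2)),
    mul_nonneg (abs_nonneg (ξ 1)) (abs_nonneg (ξ 2))]

lemma norm_mul_norm_le_sum_coordMul (a : Space → ℂ) (ξ : Space) :
    ‖ξ‖ * ‖a ξ‖ ≤ ∑ i, ‖coordMul i a ξ‖ := by
  have h : ∀ i, |ξ i| * ‖a ξ‖ ≤ ‖coordMul i a ξ‖ := fun i => by
    simp only [coordMul, norm_mul, Complex.norm_real, Complex.norm_I, Complex.norm_ofNat,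
      Real.norm_eq_abs, abs_of_pos Real.pi_pos, mul_one]
    refine mul_le_mul_of_nonneg_right (le_mul_of_one_le_left (abs_nonneg _) ?_) (norm_nonneg _)
    linarith [Real.pi_gt_three]
  calc ‖ξ‖ * ‖a ξ‖ ≤ (∑ i, |ξ i|) * ‖a ξ‖ :=
        mul_le_mul_of_nonneg_right (norm_le_sum_abs ξ) (norm_nonneg _)
    _ = ∑ i, |ξ i| * ‖a ξ‖ := Finset.sum_mul ..
    _ ≤ _ := Finset.sum_le_sum fun i _ => h i

/-- Each power of `‖ξ‖` is traded for a spatial derivative of `g`, which is again smooth with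
compact support; the case of no powers is the trivial integral bound. -/
lemma rapidDecay_modeTransform (m : ℝ) (a b : ℂ) {g : Minkowski → ℂ} (hg : ContDiff ℝ ∞ g)
    (hc : HasCompactSupport g) : RapidDecay (modeTransform m a b g) := by
  refine ⟨continuous_modeTransform m a b hg.continuous hc, fun n => ?_⟩
  induction n generalizing g with
  | zero => exact ⟨_, fun ξ => by simpa using norm_modeTransform_le m a b hg.continuous hc ξ⟩
  | succ n ih =>
    choose C hC using fun i => ih (contDiff_spaceDeriv hg i) (hasCompactSupport_spaceDeriv hc i)
    refine ⟨∑ i, C i, fun ξ => ?_⟩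
    calc ‖ξ‖ ^ (n + 1) * ‖modeTransform m a b g ξ‖
        = ‖ξ‖ ^ n * (‖ξ‖ * ‖modeTransform m a b g ξ‖) := by ring
      _ ≤ ‖ξ‖ ^ n * ∑ i, ‖coordMul i (modeTransform m a b g) ξ‖ :=
          mul_le_mul_of_nonneg_left (norm_mul_norm_le_sum_coordMul _ ξ) (by positivity)
      _ = ∑ i, ‖ξ‖ ^ n * ‖modeTransform m a b (spaceDeriv i g) ξ‖ := by
          rw [Finset.mul_sum]
          exact Finset.sum_congr rfl fun i _ => by rw [modeTransform_spaceDeriv m a b hg hc]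
      _ ≤ ∑ i, C i := Finset.sum_le_sum fun i _ => hC i ξ

/-! ### The convolution `D * f` as a superposition of modes -/

/-- The velocity amplitude of `D * f` at time `0`. -/
def velocityAmp (m : ℝ) (f : Minkowski → ℝ) : Space → ℂ :=
  modeTransform m 0 1 fun z => (f z : ℂ)

/-- The amplitude of `D * f` at time `0`. -/
def valueAmp (m : ℝ) (f : Minkowski → ℝ) : Space → ℂ :=
  fun ξ => -modeTransform m 1 0 (fun z => (f z : ℂ)) ξ

lemma IsTestFunction.contDiff_ofReal {f : Minkowski → ℝ} (hf : IsTestFunction f) :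
    ContDiff ℝ ∞ fun z => (f z : ℂ) :=
  Complex.ofRealCLM.contDiff.comp hf.1

lemma IsTestFunction.hasCompactSupport_ofReal {f : Minkowski → ℝ} (hf : IsTestFunction f) :
    HasCompactSupport fun z => (f z : ℂ) :=
  hf.2.comp_left (g := ((↑) : ℝ → ℂ)) Complex.ofReal_zero

lemma IsTestFunction.rapidDecay_velocityAmp {f : Minkowski → ℝ} (hf : IsTestFunction f) (m : ℝ) :
    RapidDecay (velocityAmp m f) :=
  rapidDecay_modeTransform m 0 1 hf.contDiff_ofReal hf.hasCompactSupport_ofReal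

lemma IsTestFunction.rapidDecay_valueAmp {f : Minkowski → ℝ} (hf : IsTestFunction f) (m : ℝ) :
    RapidDecay (valueAmp m f) :=
  (rapidDecay_modeTransform m 1 0 hf.contDiff_ofReal hf.hasCompactSupport_ofReal).neg

/-- After the substitutions `k = 2πξ` and `z ↦ x - z`, the identity `sin (tε) = ε S(t)` cancels the
factor `1 / ε` of the definition. -/
lemma pauliJordanMode_two_pi_smul_eq_integral (m : ℝ) (f : Minkowski → ℝ) (x : Minkowski)
    {ξ : Space} (h : freq m ξ ≠ 0) :
    pauliJordanMode m (fun z => (f (x - z) : ℂ)) ((2 * Real.pi) • ξ) =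
      (((2 * Real.pi) ^ 3 : ℝ) : ℂ)⁻¹ *
        ∫ z, planeWave (x.2 - z.2) ξ * (sinKernel m (x.1 - z.1) ξ : ℂ) * f z := by
  have hint : (∫ z : Minkowski,
      Complex.exp (Complex.I * ((⟪z.2, (2 * Real.pi) • ξ⟫ : ℝ) : ℂ)) *
        ((Real.sin (z.1 * energy m ((2 * Real.pi) • ξ)) : ℝ) : ℂ) * (f (x - z) : ℂ)) =
      (freq m ξ : ℂ) *
        ∫ z, planeWave (x.2 - z.2) ξ * (sinKernel m (x.1 - z.1) ξ : ℂ) * f z := by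
    rw [← integral_const_mul, ← integral_sub_left_eq_self _ _ x]
    congr 1
    funext z
    rw [sub_sub_cancel]
    change _ * ((Real.sin ((x.1 - z.1) * freq m ξ) : ℝ) : ℂ) * _ = _
    rw [← freq_mul_sinKernel, planeWave, inner_smul_right, mul_comm Complex.I,
      real_inner_comm ξ, Prod.snd_sub]
    push_cast
    ring
  rw [pauliJordanMode, hint]
  change ((((2 * Real.pi) ^ 3 * freq m ξ : ℝ) : ℂ))⁻¹ * _ = _
  have h' : (freq m ξ : ℂ) ≠ 0 := Complex.ofReal_ne_zero.2 h
  rw [Complex.ofReal_mul, mul_inv, mul_assoc, inv_mul_cancel_left₀ h']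

lemma integral_sinKernel_sub_eq_mode {f : Minkowski → ℝ} (hf : IsTestFunction f) (m : ℝ)
    (x : Minkowski) (ξ : Space) :
    ∫ z, planeWave (x.2 - z.2) ξ * (sinKernel m (x.1 - z.1) ξ : ℂ) * f z =
      mode m (velocityAmp m f) (valueAmp m f) x ξ := by
  have hc := hf.contDiff_ofReal.continuous
  have hs := hf.hasCompactSupport_ofReal
  simp only [mode, amplitude, velocityAmp, valueAmp, modeTransform]
  rw [← integral_neg, ← integral_const_mul, ← integral_const_mul, ← integral_add,
    ← integral_const_mul]
  · congr 1
    funext z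
    rw [sub_eq_add_neg, planeWave_add, sinKernel_sub, planeWave_neg_right, sinKernel_neg_right,
      cosKernel_neg_right]
    push_cast
    ring
  · exact (integrable_mode_mul m 0 1 hc hs (-ξ)).const_mul _
  · exact (integrable_mode_mul m 1 0 hc hs (-ξ)).neg.const_mul _

/-- The frequency can vanish only at `ξ = 0`, a null set. There the literal `1 / ε` of the
definition has the default value `0`, while `S` does not see the singularity. -/
lemma ae_freq_ne_zero (m : ℝ) : ∀ᵐ ξ : Space, freq m ξ ≠ 0 := by
  have h : ∀ᵐ ξ : Space, ξ ≠ 0 := by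
    rw [ae_iff]
    simp
  filter_upwards [h] with ξ hξ h0
  have h1 := freq_sq m ξ
  rw [h0] at h1
  have h2 : 0 < (2 * Real.pi) ^ 2 * ‖ξ‖ ^ 2 := by
    have := Real.pi_pos
    have := norm_pos_iff.2 hξ
    positivity
  nlinarith [sq_nonneg m]

lemma pauliJordanMode_two_pi_smul_ae {f : Minkowski → ℝ} (hf : IsTestFunction f) (m : ℝ)
    (x : Minkowski) :
    (fun ξ => pauliJordanMode m (fun z => (f (x - z) : ℂ)) ((2 * Real.pi) • ξ)) =ᵐ[volume]
      fun ξ => (((2 * Real.pi) ^ 3 : ℝ) : ℂ)⁻¹ *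
        mode m (velocityAmp m f) (valueAmp m f) x ξ := by
  filter_upwards [ae_freq_ne_zero m] with ξ hξ
  rw [pauliJordanMode_two_pi_smul_eq_integral m f x hξ, integral_sinKernel_sub_eq_mode hf]

lemma integrable_pauliJordanMode {f : Minkowski → ℝ} (hf : IsTestFunction f) (m : ℝ)
    (x : Minkowski) : Integrable (pauliJordanMode m fun z => (f (x - z) : ℂ)) := by
  have h := (integrable_mode (hf.rapidDecay_velocityAmp m) (hf.rapidDecay_valueAmp m) m x).const_mul
    (((2 * Real.pi) ^ 3 : ℝ) : ℂ)⁻¹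
  refine (integrable_comp_smul_iff volume _ (R := 2 * Real.pi) ?_).1
    (h.congr (pauliJordanMode_two_pi_smul_ae hf m x).symm)
  exact mul_ne_zero two_ne_zero Real.pi_ne_zero

/-- The Jacobian `(2π)³` of `k = 2πξ` cancels the normalisation of `D`. -/
lemma pauliJordanConv_eq_modeSolution {f : Minkowski → ℝ} (hf : IsTestFunction f) (m : ℝ) :
    pauliJordanConv m f = modeSolution m (velocityAmp m f) (valueAmp m f) := by
  funext x
  have h0 : (0 : ℝ) < (2 * Real.pi) ^ 3 := by positivity
  have h1 := Measure.integral_comp_smul (volume : Measure Space)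
    (pauliJordanMode m fun z => (f (x - z) : ℂ)) (2 * Real.pi)
  rw [integral_congr_ae (pauliJordanMode_two_pi_smul_ae hf m x), integral_const_mul,
    finrank_euclideanSpace_fin, abs_of_pos (inv_pos.2 h0), Complex.real_smul,
    Complex.ofReal_inv] at h1
  exact (mul_left_cancel₀ (inv_ne_zero (Complex.ofReal_ne_zero.2 h0.ne')) h1).symm

/-! ### Reality of `D * f` -/

lemma conj_mode {A B : Space → ℂ} (hA : ∀ ξ, (starRingEnd ℂ) (A ξ) = A (-ξ))
    (hB : ∀ ξ, (starRingEnd ℂ) (B ξ) = B (-ξ)) (m : ℝ) (x : Minkowski) (ξ : Space) :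
    (starRingEnd ℂ) (mode m A B x ξ) = mode m A B x (-ξ) := by
  simp only [mode, amplitude, map_mul, map_add, conj_planeWave, Complex.conj_ofReal, hA, hB,
    planeWave_neg_right, sinKernel_neg_right, cosKernel_neg_right]

lemma conj_modeTransform (m : ℝ) {a b : ℂ} (ha : (starRingEnd ℂ) a = a)
    (hb : (starRingEnd ℂ) b = b) (f : Minkowski → ℝ) (ξ : Space) :
    (starRingEnd ℂ) (modeTransform m a b (fun z => (f z : ℂ)) ξ) =
      modeTransform m a b (fun z => (f z : ℂ)) (-ξ) := by
  rw [modeTransform, modeTransform, ← integral_conj]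
  congr 1
  funext z
  rw [map_mul, conj_mode (fun _ => ha) (fun _ => hb), Complex.conj_ofReal]

/-- Under the symmetry `conj A(ξ) = A(-ξ)`, conjugation acts on the integrand as `ξ ↦ -ξ`, which
preserves the integral. -/
lemma modeSolution_im_eq_zero {A B : Space → ℂ} (hA : ∀ ξ, (starRingEnd ℂ) (A ξ) = A (-ξ))
    (hB : ∀ ξ, (starRingEnd ℂ) (B ξ) = B (-ξ)) (m : ℝ) (x : Minkowski) :
    (modeSolution m A B x).im = 0 := by
  rw [← Complex.conj_eq_iff_im]
  change (starRingEnd ℂ) (∫ ξ, mode m A B x ξ) = ∫ ξ, mode m A B x ξ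
  rw [← integral_conj]
  simp only [conj_mode hA hB]
  exact integral_neg_eq_self _ _

lemma pauliJordanConv_im {f : Minkowski → ℝ} (hf : IsTestFunction f) (m : ℝ) (x : Minkowski) :
    (pauliJordanConv m f x).im = 0 := by
  rw [pauliJordanConv_eq_modeSolution hf]
  refine modeSolution_im_eq_zero (fun ξ => conj_modeTransform m (map_zero _) (map_one _) f ξ)
    (fun ξ => ?_) m x
  rw [valueAmp, valueAmp, map_neg, conj_modeTransform m (map_one _) (map_zero _) f ξ]

/-! ### Functions with locally uniformly bounded support in space -/

/-- The spatial support of `F` at time `t` is bounded uniformly for `t` in bounded sets. -/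
def SpaceBounded {E : Type*} [Zero E] (F : Minkowski → E) : Prop :=
  ∀ T : ℝ, ∃ R : ℝ, ∀ t x, |t| ≤ T → R < ‖x‖ → F (t, x) = 0

section SpaceBounded

variable {E : Type*} [NormedAddCommGroup E] [NormedSpace ℝ E]

lemma SpaceBounded.mul_left {G F : Minkowski → ℂ} (hF : SpaceBounded F) :
    SpaceBounded fun p => G p * F p := fun T => by
  obtain ⟨R, hR⟩ := hF T
  exact ⟨R, fun t x ht hx => by simp [hR t x ht hx]⟩

lemma SpaceBounded.hasCompactSupport {E : Type*} [NormedAddCommGroup E] {F : Minkowski → E} (hF : SpaceBounded F) (t : ℝ) :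
    HasCompactSupport fun x => F (t, x) := by
  obtain ⟨R, hR⟩ := hF |t|
  refine HasCompactSupport.intro (isCompact_closedBall 0 R) fun x hx => hR t x le_rfl ?_
  simpa using hx

lemma SpaceBounded.integrable {E : Type*} [NormedAddCommGroup E] {F : Minkowski → E} (hF : SpaceBounded F) (hc : Continuous F)
    (t : ℝ) : Integrable fun x => F (t, x) :=
  Continuous.integrable_of_hasCompactSupport (by fun_prop) (hF.hasCompactSupport t)

lemma SpaceBounded.fderiv_apply {F : Minkowski → E} (hF : SpaceBounded F) (w : Minkowski) :
    SpaceBounded fun p => fderiv ℝ F p w := fun T => by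
  -- The extra unit of time makes `F` vanish on a neighbourhood of each point with `|t| ≤ T` and
  -- `‖x‖ > R`, so its derivative vanishes there too.
  obtain ⟨R, hR⟩ := hF (T + 1)
  refine ⟨R, fun t x ht hx => ?_⟩
  have h : F =ᶠ[𝓝 (t, x)] fun _ => 0 := by
    have h1 : ∀ᶠ p : Minkowski in 𝓝 (t, x), |p.1| < T + 1 :=
      (continuous_fst.abs.tendsto (t, x)).eventually_lt_const (by simp; linarith)
    have h2 : ∀ᶠ p : Minkowski in 𝓝 (t, x), R < ‖p.2‖ :=
      (continuous_snd.norm.tendsto (t, x)).eventually_const_lt (by simpa using hx)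
    filter_upwards [h1, h2] with p hp1 hp2 using hR p.1 p.2 hp1.le hp2
  simp [h.fderiv_eq]

lemma hasDerivAt_slice {F : Minkowski → E} (hF : Differentiable ℝ F) (t : ℝ) (x : Space) :
    HasDerivAt (fun t => F (t, x)) (fderiv ℝ F (t, x) (1, 0)) t := by
  have h : HasDerivAt (fun t : ℝ => ((t, x) : Minkowski)) (1, 0) t :=
    (hasDerivAt_id t).prodMk (hasDerivAt_const t x)
  exact (hF (t, x)).hasFDerivAt.comp_hasDerivAt t h

lemma fderiv_slice {F : Minkowski → E} (hF : Differentiable ℝ F) (t : ℝ) (x w : Space) :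
    fderiv ℝ (fun x => F (t, x)) x w = fderiv ℝ F (t, x) (0, w) := by
  have h : HasFDerivAt (fun x : Space => ((t, x) : Minkowski)) (ContinuousLinearMap.inr ℝ ℝ Space) x :=
    hasFDerivAt_prodMk_right t x
  have := ((hF (t, x)).hasFDerivAt.comp x h).fderiv
  change fderiv ℝ (F ∘ fun x => (t, x)) x w = _
  rw [this]
  simp

lemma SpaceBounded.hasDerivAt_integral {F : Minkowski → E} (hF : SpaceBounded F)
    (hd : ContDiff ℝ 1 F) (t : ℝ) :
    HasDerivAt (fun t => ∫ x, F (t, x)) (∫ x, fderiv ℝ F (t, x) (1, 0)) t := by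
  have hdc : Continuous fun p => fderiv ℝ F p (1, 0) :=
    (hd.continuous_fderiv (by simp)).clm_apply continuous_const
  obtain ⟨R, hR⟩ := hF.fderiv_apply (1, 0) (|t| + 1)
  obtain ⟨C, hC⟩ := ((isCompact_closedBall t 1).prod (isCompact_closedBall (0 : Space) R)).bddAbove_image
    hdc.norm.continuousOn
  refine (hasDerivAt_integral_of_dominated_loc_of_deriv_le (μ := (volume : Measure Space))
    (F := fun t x => F (t, x)) (F' := fun t x => fderiv ℝ F (t, x) (1, 0))
    (Metric.ball_mem_nhds t one_pos)
    (bound := (Metric.closedBall (0 : Space) R).indicator fun _ => C)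
    (Eventually.of_forall fun s => (hF.integrable hd.continuous s).aestronglyMeasurable)
    (hF.integrable hd.continuous t)
    ((hF.fderiv_apply (1, 0)).integrable hdc t).aestronglyMeasurable
    (Eventually.of_forall fun x s hs => ?_) ?_
    (Eventually.of_forall fun x s _ => hasDerivAt_slice (hd.differentiable (by simp)) s x)).2
  · have hs' : |s - t| < 1 := by simpa [Real.dist_eq] using hs
    by_cases hx : x ∈ Metric.closedBall (0 : Space) R
    · rw [Set.indicator_of_mem hx]
      exact hC ⟨(s, x), ⟨Metric.ball_subset_closedBall hs, hx⟩, rfl⟩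
    · have hz : fderiv ℝ F (s, x) (1, 0) = 0 := by
        refine hR s x ?_ (by simpa using hx)
        have := abs_sub_abs_le_abs_sub s t
        linarith
      rw [Set.indicator_of_notMem hx, hz, norm_zero]
  · exact (integrable_indicator_iff Metric.isClosed_closedBall.measurableSet).2
      (integrableOn_const (isCompact_closedBall _ _).measure_ne_top)

lemma SpaceBounded.integral_fderiv_eq_zero {F : Minkowski → E} (hF : SpaceBounded F)
    (hd : ContDiff ℝ 1 F) (t : ℝ) (w : Space) : ∫ x, fderiv ℝ F (t, x) (0, w) = 0 := by
  have hdc : Continuous fun p => fderiv ℝ F p (0, w) :=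
    (hd.continuous_fderiv (by simp)).clm_apply continuous_const
  have hdiff := hd.differentiable (by simp)
  -- Integration by parts against the constant function `1`.
  have h := integral_smul_fderiv_eq_neg_fderiv_smul_of_integrable (μ := (volume : Measure Space))
    (f := fun _ => (1 : ℝ)) (g := fun x => F (t, x)) (v := w) (by simp)
    (by simpa only [one_smul, fderiv_slice hdiff] using (hF.fderiv_apply (0, w)).integrable hdc t)
    (by simpa only [one_smul] using hF.integrable hd.continuous t)
    (fun _ _ => differentiableAt_const _)
    (fun x _ => (hdiff.comp (by fun_prop : Differentiable ℝ fun x : Space => ((t, x) : Minkowski))) x)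
  simpa [fderiv_slice hdiff] using h

end SpaceBounded

/-! ### Energy estimate -/

/-- The coordinate vector `∂₀`. -/
def timeVec : Minkowski := ((1 : ℝ), (0 : Space))

/-- The coordinate vector `∂ᵢ`. -/
def spaceVec (i : Fin 3) : Minkowski := ((0 : ℝ), EuclideanSpace.single i (1 : ℝ))

/-- The derivative of `v` in the direction `w`. -/
def dirDeriv (w : Minkowski) (v : Minkowski → ℝ) (p : Minkowski) : ℝ := fderiv ℝ v p w

lemma contDiff_dirDeriv {v : Minkowski → ℝ} (hv : ContDiff ℝ ∞ v) (w : Minkowski) :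
    ContDiff ℝ ∞ (dirDeriv w v) :=
  (hv.fderiv_right (by simp)).clm_apply contDiff_const

lemma dirDeriv_comm {v : Minkowski → ℝ} (hv : ContDiff ℝ ∞ v) (w w' p : Minkowski) :
    dirDeriv w (dirDeriv w' v) p = dirDeriv w' (dirDeriv w v) p := by
  have h : ∀ a b : Minkowski, dirDeriv a (dirDeriv b v) p = fderiv ℝ (fderiv ℝ v) p a b := by
    intro a b
    have hd : DifferentiableAt ℝ (fderiv ℝ v) p :=
      ((hv.fderiv_right (m := ∞) (by simp)).differentiable (by simp)) p
    unfold dirDeriv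
    rw [fderiv_clm_apply hd (differentiableAt_const _)]
    simp
  rw [h, h]
  exact ((contDiff_infty.1 hv 2).contDiffAt.isSymmSndFDerivAt (by simp)) w w'

lemma dirDeriv_mul {u v : Minkowski → ℝ} (hu : ContDiff ℝ ∞ u) (hv : ContDiff ℝ ∞ v)
    (w p : Minkowski) :
    dirDeriv w (fun p => u p * v p) p = dirDeriv w u p * v p + u p * dirDeriv w v p := by
  unfold dirDeriv
  rw [fderiv_fun_mul (hu.differentiable (by simp) p) (hv.differentiable (by simp) p)]
  simp
  ring

lemma dirDeriv_add {u v : Minkowski → ℝ} (hu : ContDiff ℝ ∞ u) (hv : ContDiff ℝ ∞ v)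
    (w p : Minkowski) :
    dirDeriv w (fun p => u p + v p) p = dirDeriv w u p + dirDeriv w v p := by
  unfold dirDeriv
  rw [fderiv_fun_add (hu.differentiable (by simp) p) (hv.differentiable (by simp) p)]
  simp

lemma dirDeriv_const_mul {v : Minkowski → ℝ} (hv : ContDiff ℝ ∞ v) (c : ℝ) (w p : Minkowski) :
    dirDeriv w (fun p => c * v p) p = c * dirDeriv w v p := by
  unfold dirDeriv
  rw [fderiv_const_mul (hv.differentiable (by simp) p)]
  simp

/-- The Klein-Gordon equation for real functions, as an equation for `∂₀²v`. -/
def RealKleinGordon (m : ℝ) (v : Minkowski → ℝ) : Prop :=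
  ContDiff ℝ ∞ v ∧ ∀ p, dirDeriv timeVec (dirDeriv timeVec v) p =
    ∑ i, dirDeriv (spaceVec i) (dirDeriv (spaceVec i) v) p - m ^ 2 * v p

/-- Twice the energy density. -/
def energyDensity (m : ℝ) (v : Minkowski → ℝ) (p : Minkowski) : ℝ :=
  dirDeriv timeVec v p * dirDeriv timeVec v p +
    (dirDeriv (spaceVec 0) v p * dirDeriv (spaceVec 0) v p +
      (dirDeriv (spaceVec 1) v p * dirDeriv (spaceVec 1) v p +
        (dirDeriv (spaceVec 2) v p * dirDeriv (spaceVec 2) v p + m ^ 2 * (v p * v p))))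

lemma contDiff_energyDensity {v : Minkowski → ℝ} (hv : ContDiff ℝ ∞ v) (m : ℝ) :
    ContDiff ℝ ∞ (energyDensity m v) := by
  have h := contDiff_dirDeriv hv
  unfold energyDensity
  fun_prop

lemma energyDensity_nonneg (m : ℝ) (v : Minkowski → ℝ) (p : Minkowski) :
    0 ≤ energyDensity m v p := by
  have := mul_nonneg (sq_nonneg m) (mul_self_nonneg (v p))
  have h := fun w => mul_self_nonneg (dirDeriv w v p)
  exact add_nonneg (h _) (add_nonneg (h _) (add_nonneg (h _) (add_nonneg (h _) this)))

/-! ### Weighted energy in a light cone -/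

/-- The function `(R - t)² - |x - x₀|²`, positive inside the light cone with apex `(R, x₀)`. -/
def coneFun (R : ℝ) (x₀ : Space) (p : Minkowski) : ℝ := (R - p.1) ^ 2 - ‖p.2 - x₀‖ ^ 2

/-- A smooth weight supported in the light cone with apex `(R, x₀)`. -/
def coneWeight (R : ℝ) (x₀ : Space) (p : Minkowski) : ℝ := expNegInvGlue (coneFun R x₀ p)

lemma contDiff_coneFun (R : ℝ) (x₀ : Space) : ContDiff ℝ ∞ (coneFun R x₀) := by
  unfold coneFun
  exact ((contDiff_const.sub contDiff_fst).pow 2).sub ((contDiff_snd.sub contDiff_const).norm_sq ℝ)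

lemma contDiff_coneWeight (R : ℝ) (x₀ : Space) : ContDiff ℝ ∞ (coneWeight R x₀) :=
  expNegInvGlue.contDiff.comp (contDiff_coneFun R x₀)

lemma dirDeriv_coneWeight (R : ℝ) (x₀ : Space) (w p : Minkowski) :
    dirDeriv w (coneWeight R x₀) p = deriv expNegInvGlue (coneFun R x₀ p) *
      (-2 * (R - p.1) * w.1 - 2 * ⟪p.2 - x₀, w.2⟫) := by
  have h1 : HasFDerivAt (fun p : Minkowski => (R - p.1) ^ 2)
      ((2 * (R - p.1) ^ (2 - 1)) • (-ContinuousLinearMap.fst ℝ ℝ Space)) p := by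
    have := ((ContinuousLinearMap.fst ℝ ℝ Space).hasFDerivAt (x := p)).const_sub R
    simpa only [nsmul_eq_mul, Nat.cast_ofNat] using! this.pow 2
  have h2 : HasFDerivAt (fun p : Minkowski => ‖p.2 - x₀‖ ^ 2)
      (2 • (innerSL ℝ (p.2 - x₀)).comp (ContinuousLinearMap.snd ℝ ℝ Space)) p :=
    (((ContinuousLinearMap.snd ℝ ℝ Space).hasFDerivAt (x := p)).sub_const x₀).norm_sq
  have h3 : HasDerivAt expNegInvGlue (deriv expNegInvGlue (coneFun R x₀ p)) (coneFun R x₀ p) :=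
    ((expNegInvGlue.contDiff (n := 1)).differentiable (by simp) _).hasDerivAt
  have h4 : HasFDerivAt (coneWeight R x₀) _ p := h3.comp_hasFDerivAt p (h1.sub h2)
  rw [dirDeriv, h4.fderiv]
  simp [inner_sub_left]

lemma spaceBounded_coneWeight_mul (R : ℝ) (x₀ : Space) (G : Minkowski → ℝ) :
    SpaceBounded fun p => coneWeight R x₀ p * G p := fun T => by
  refine ⟨|R| + T + ‖x₀‖, fun t x ht hx => ?_⟩
  have h : coneFun R x₀ (t, x) ≤ 0 := by
    have h1 : |R - t| ≤ |R| + |t| := abs_sub _ _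
    have h2 : ‖x‖ ≤ ‖x - x₀‖ + ‖x₀‖ := norm_le_norm_sub_add x x₀
    have h3 : |R - t| ≤ ‖x - x₀‖ := by linarith
    have h4 := pow_le_pow_left₀ (abs_nonneg _) h3 2
    rw [sq_abs] at h4
    simp only [coneFun]
    linarith
  simp only [coneWeight, expNegInvGlue.zero_of_nonpos h, zero_mul]

lemma deriv_expNegInvGlue_nonneg (x : ℝ) : 0 ≤ deriv expNegInvGlue x :=
  expNegInvGlue.monotone.deriv_nonneg

lemma deriv_expNegInvGlue_of_neg {x : ℝ} (hx : x < 0) : deriv expNegInvGlue x = 0 := by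
  have h : expNegInvGlue =ᶠ[𝓝 x] fun _ => 0 := by
    filter_upwards [Iio_mem_nhds hx] with y hy using expNegInvGlue.zero_of_nonpos hy.le
  rw [h.deriv_eq, deriv_const]

/-- The weighted energy on the time slice `t`. -/
def coneEnergy (m R : ℝ) (x₀ : Space) (v : Minkowski → ℝ) (t : ℝ) : ℝ :=
  ∫ x, coneWeight R x₀ (t, x) * energyDensity m v (t, x)

/-- The part of the time derivative of the weighted energy density that is not a divergence. -/
def coneFlux (m R : ℝ) (x₀ : Space) (v : Minkowski → ℝ) (p : Minkowski) : ℝ :=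
  dirDeriv timeVec (coneWeight R x₀) p * energyDensity m v p -
    2 * ∑ i, dirDeriv (spaceVec i) (coneWeight R x₀) p *
      (dirDeriv timeVec v p * dirDeriv (spaceVec i) v p)

/-- The `i`-th component of the weighted momentum density. -/
def coneCurrent (R : ℝ) (x₀ : Space) (v : Minkowski → ℝ) (i : Fin 3) (p : Minkowski) : ℝ :=
  coneWeight R x₀ p * (dirDeriv timeVec v p * dirDeriv (spaceVec i) v p)

lemma contDiff_coneCurrent {v : Minkowski → ℝ} (hv : ContDiff ℝ ∞ v) (R : ℝ) (x₀ : Space)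
    (i : Fin 3) : ContDiff ℝ ∞ (coneCurrent R x₀ v i) :=
  (contDiff_coneWeight R x₀).mul ((contDiff_dirDeriv hv _).mul (contDiff_dirDeriv hv _))

lemma dirDeriv_energyDensity {v : Minkowski → ℝ} (hv : ContDiff ℝ ∞ v) (m : ℝ) (w p : Minkowski) :
    dirDeriv w (energyDensity m v) p =
      2 * dirDeriv timeVec v p * dirDeriv w (dirDeriv timeVec v) p +
      2 * ∑ i, dirDeriv (spaceVec i) v p * dirDeriv w (dirDeriv (spaceVec i) v) p +
      2 * m ^ 2 * v p * dirDeriv w v p := by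
  have h := contDiff_dirDeriv hv
  have hh := fun w => (h w).mul (h w)
  have hm : ContDiff ℝ ∞ fun p => m ^ 2 * (v p * v p) := contDiff_const.mul (hv.mul hv)
  unfold energyDensity
  rw [dirDeriv_add (hh _) ((hh _).add ((hh _).add ((hh _).add hm))),
    dirDeriv_add (hh _) ((hh _).add ((hh _).add hm)),
    dirDeriv_add (hh _) ((hh _).add hm), dirDeriv_add (hh _) hm,
    dirDeriv_const_mul (hv.mul hv), dirDeriv_mul hv hv]
  simp only [dirDeriv_mul (h _) (h _), Fin.sum_univ_three]
  ring

/-- Local energy balance: the equation replaces `∂₀²v`, the mass terms cancel, and symmetry of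
second derivatives turns the rest into a divergence, up to the terms that differentiate the weight.
-/
lemma dirDeriv_weighted_energyDensity {m : ℝ} {v : Minkowski → ℝ} (hv : RealKleinGordon m v)
    (R : ℝ) (x₀ : Space) (p : Minkowski) :
    dirDeriv timeVec (fun p => coneWeight R x₀ p * energyDensity m v p) p =
      coneFlux m R x₀ v p + 2 * ∑ i, dirDeriv (spaceVec i) (coneCurrent R x₀ v i) p := by
  have h := contDiff_dirDeriv hv.1
  have hφ := contDiff_coneWeight R x₀
  have hc : ∀ i, dirDeriv (spaceVec i) (coneCurrent R x₀ v i) p =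
      dirDeriv (spaceVec i) (coneWeight R x₀) p *
        (dirDeriv timeVec v p * dirDeriv (spaceVec i) v p) +
      coneWeight R x₀ p * (dirDeriv timeVec (dirDeriv (spaceVec i) v) p * dirDeriv (spaceVec i) v p
        + dirDeriv timeVec v p * dirDeriv (spaceVec i) (dirDeriv (spaceVec i) v) p) := fun i => by
    unfold coneCurrent
    rw [dirDeriv_mul hφ ((h _).mul (h _)), dirDeriv_mul (h _) (h _),
      dirDeriv_comm hv.1 (spaceVec i) timeVec]
  rw [dirDeriv_mul hφ (contDiff_energyDensity hv.1 m), dirDeriv_energyDensity hv.1, hv.2]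
  simp only [hc, coneFlux, Fin.sum_univ_three]
  ring

lemma two_mul_mul_le_of_sq_le {a r S V : ℝ} (hr : 0 ≤ r) (hV : 0 ≤ V) (h : S ^ 2 ≤ r ^ 2 * V) :
    2 * a * S ≤ r * (a ^ 2 + V) := by
  have h1 : |S| ≤ r * Real.sqrt V := by
    refine abs_le_of_sq_le_sq ?_ (by positivity)
    rwa [mul_pow, Real.sq_sqrt hV]
  have h2 : 2 * a * S ≤ 2 * |a| * |S| := by
    rw [mul_assoc, mul_assoc, ← abs_mul]
    linarith [le_abs_self (a * S)]
  have h3 : 2 * |a| * |S| ≤ 2 * |a| * (r * Real.sqrt V) := by gcongr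
  have h4 : 0 ≤ r * (|a| - Real.sqrt V) ^ 2 := by positivity
  nlinarith [Real.sq_sqrt hV, sq_abs a]

/-- Outside the cone the derivative of the weight is zero. Inside it, with `y = x⃗ - x₀` and `|y| ≤
R - t`, Cauchy-Schwarz gives `2 ∂₀v (y·∇v) ≤ (R - t)((∂₀v)² + |∇v|²)`: energy flows no faster than
light, so the shrinking weight dominates the flux. -/
lemma coneFlux_nonpos (m : ℝ) {R : ℝ} (x₀ : Space) (v : Minkowski → ℝ) {p : Minkowski}
    (hp : p.1 ≤ R) : coneFlux m R x₀ v p ≤ 0 := by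
  by_cases hq : coneFun R x₀ p < 0
  · simp [coneFlux, dirDeriv_coneWeight, deriv_expNegInvGlue_of_neg hq]
  · set D := deriv expNegInvGlue (coneFun R x₀ p) with hD
    have hD0 : 0 ≤ D := deriv_expNegInvGlue_nonneg _
    set y := p.2 - x₀ with hy
    have hn : y 0 ^ 2 + y 1 ^ 2 + y 2 ^ 2 ≤ (R - p.1) ^ 2 := by
      have h1 : ‖y‖ ^ 2 = y 0 ^ 2 + y 1 ^ 2 + y 2 ^ 2 := by
        rw [EuclideanSpace.norm_sq_eq, Fin.sum_univ_three]
        simp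
      rw [coneFun, not_lt] at hq
      linarith
    set a := dirDeriv timeVec v p with ha
    set b : Fin 3 → ℝ := fun i => dirDeriv (spaceVec i) v p with hb
    have hcs : (y 0 * b 0 + y 1 * b 1 + y 2 * b 2) ^ 2 ≤
        (R - p.1) ^ 2 * (b 0 ^ 2 + b 1 ^ 2 + b 2 ^ 2) := by
      refine le_trans ?_ (mul_le_mul_of_nonneg_right hn (by positivity))
      nlinarith [sq_nonneg (y 0 * b 1 - y 1 * b 0), sq_nonneg (y 0 * b 2 - y 2 * b 0),
        sq_nonneg (y 1 * b 2 - y 2 * b 1)]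
    have key := two_mul_mul_le_of_sq_le (a := a) (sub_nonneg.2 hp) (by positivity) hcs
    have hflux : coneFlux m R x₀ v p = -2 * D * ((R - p.1) *
        (a ^ 2 + (b 0 ^ 2 + b 1 ^ 2 + b 2 ^ 2) + m ^ 2 * v p ^ 2) -
        2 * a * (y 0 * b 0 + y 1 * b 1 + y 2 * b 2)) := by
      simp [coneFlux, dirDeriv_coneWeight, timeVec, spaceVec, energyDensity, Fin.sum_univ_three,
        EuclideanSpace.inner_single_right, hD, hy, ha, hb]
      ring
    rw [hflux]
    have h2 : 0 ≤ (R - p.1) * (m ^ 2 * v p ^ 2) :=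
      mul_nonneg (sub_nonneg.2 hp) (by positivity)
    have h3 : 0 ≤ 2 * D * ((R - p.1) *
        (a ^ 2 + (b 0 ^ 2 + b 1 ^ 2 + b 2 ^ 2) + m ^ 2 * v p ^ 2) -
        2 * a * (y 0 * b 0 + y 1 * b 1 + y 2 * b 2)) :=
      mul_nonneg (by positivity) (by linarith)
    linarith

/-- The weight bounds the spatial support on slices, so the divergence in the local balance
integrates to zero. -/
lemma hasDerivAt_coneEnergy {m : ℝ} {v : Minkowski → ℝ} (hv : RealKleinGordon m v)
    (R : ℝ) (x₀ : Space) (t : ℝ) :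
    HasDerivAt (coneEnergy m R x₀ v) (∫ x, coneFlux m R x₀ v (t, x)) t := by
  have hd : ContDiff ℝ 1 fun p => coneWeight R x₀ p * energyDensity m v p :=
    ((contDiff_coneWeight R x₀).mul (contDiff_energyDensity hv.1 m)).of_le (by simp)
  have hb := spaceBounded_coneWeight_mul R x₀ (energyDensity m v)
  have hcd := fun i => (contDiff_coneCurrent hv.1 R x₀ i)
  have hcb : ∀ i, SpaceBounded (coneCurrent R x₀ v i) := fun i =>
    spaceBounded_coneWeight_mul R x₀ _
  have hi : ∀ i, Integrable fun x => dirDeriv (spaceVec i) (coneCurrent R x₀ v i) (t, x) := fun i =>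
    ((hcb i).fderiv_apply (spaceVec i)).integrable (contDiff_dirDeriv (hcd i) _).continuous t
  have hE : Integrable fun x =>
      dirDeriv timeVec (fun p => coneWeight R x₀ p * energyDensity m v p) (t, x) :=
    (hb.fderiv_apply timeVec).integrable (contDiff_dirDeriv
      ((contDiff_coneWeight R x₀).mul (contDiff_energyDensity hv.1 m)) _).continuous t
  have hS : Integrable fun x => 2 * ∑ i, dirDeriv (spaceVec i) (coneCurrent R x₀ v i) (t, x) :=
    (integrable_finsetSum Finset.univ fun i _ => hi i).const_mul 2
  refine (hb.hasDerivAt_integral hd t).congr_deriv ?_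
  have h1 : ∀ x, coneFlux m R x₀ v (t, x) =
      dirDeriv timeVec (fun p => coneWeight R x₀ p * energyDensity m v p) (t, x) -
        2 * ∑ i, dirDeriv (spaceVec i) (coneCurrent R x₀ v i) (t, x) := fun x => by
    rw [dirDeriv_weighted_energyDensity hv]
    ring
  have h2 : ∀ i, ∫ x, dirDeriv (spaceVec i) (coneCurrent R x₀ v i) (t, x) = 0 := fun i =>
    (hcb i).integral_fderiv_eq_zero ((hcd i).of_le (by simp)) t _
  simp only [h1]
  rw [integral_sub hE hS, integral_const_mul, integral_finsetSum Finset.univ fun i _ => hi i]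
  simp only [h2, Finset.sum_const_zero, mul_zero, sub_zero]
  rfl

lemma coneEnergy_nonneg (m R : ℝ) (x₀ : Space) (v : Minkowski → ℝ) (t : ℝ) :
    0 ≤ coneEnergy m R x₀ v t :=
  integral_nonneg fun _ => mul_nonneg (expNegInvGlue.nonneg _) (energyDensity_nonneg _ _ _)

lemma energyDensity_eq_zero_of_initial {m R : ℝ} {x₀ : Space} {v : Minkowski → ℝ}
    (hv : RealKleinGordon m v)
    (h0 : ∀ x, ‖x - x₀‖ < R → v (0, x) = 0)
    (h1 : ∀ x, ‖x - x₀‖ < R → dirDeriv timeVec v (0, x) = 0)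
    {x : Space} (hx : ‖x - x₀‖ < R) : energyDensity m v (0, x) = 0 := by
  have hs : ∀ i, dirDeriv (spaceVec i) v (0, x) = 0 := fun i => by
    have h : (fun y => v (0, y)) =ᶠ[𝓝 x] fun _ => 0 := by
      have : ∀ᶠ y in 𝓝 x, ‖y - x₀‖ < R :=
        (by fun_prop : Continuous fun y : Space => ‖y - x₀‖).continuousAt.eventually_lt_const hx
      filter_upwards [this] with y hy using h0 y hy
    have h2 := fderiv_slice (hv.1.differentiable (by simp)) 0 x (EuclideanSpace.single i (1 : ℝ))
    rw [h.fderiv_eq] at h2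
    simpa [dirDeriv, spaceVec] using h2.symm
  simp [energyDensity, hs, h0 x hx, h1 x hx]

/-- **Finite propagation speed**: a solution with vanishing initial data on a ball vanishes over
the centre of the ball for times less than the radius. -/
lemma RealKleinGordon.eq_zero_of_initial {m R : ℝ} {x₀ : Space} {v : Minkowski → ℝ}
    (hv : RealKleinGordon m v)
    (h0 : ∀ x, ‖x - x₀‖ < R → v (0, x) = 0)
    (h1 : ∀ x, ‖x - x₀‖ < R → dirDeriv timeVec v (0, x) = 0)
    {t : ℝ} (ht : 0 ≤ t) (htR : t < R) : v (t, x₀) = 0 := by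
  have hE0 : coneEnergy m R x₀ v 0 = 0 := by
    refine integral_eq_zero_of_ae (Eventually.of_forall fun x => ?_)
    change coneWeight R x₀ (0, x) * energyDensity m v (0, x) = 0
    by_cases hx : ‖x - x₀‖ < R
    · rw [energyDensity_eq_zero_of_initial hv h0 h1 hx, mul_zero]
    · rw [coneWeight, expNegInvGlue.zero_of_nonpos, zero_mul]
      have := pow_le_pow_left₀ (ht.trans htR.le) (not_lt.1 hx) 2
      simp only [coneFun, sub_zero]
      linarith
  -- Together with `hE0` and nonnegativity this makes the weighted energy vanish up to time `R`.
  have hanti : AntitoneOn (coneEnergy m R x₀ v) (Set.Icc 0 R) := by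
    refine antitoneOn_of_deriv_nonpos (convex_Icc 0 R)
      (fun s _ => (hasDerivAt_coneEnergy hv R x₀ s).continuousAt.continuousWithinAt)
      (fun s _ => (hasDerivAt_coneEnergy hv R x₀ s).differentiableAt.differentiableWithinAt)
      fun s hs => ?_
    rw [interior_Icc] at hs
    rw [(hasDerivAt_coneEnergy hv R x₀ s).deriv]
    exact integral_nonpos fun x => coneFlux_nonpos m x₀ v hs.2.le
  -- The weight is positive on the axis below the apex, so zero energy forces `∂₀v = 0` there. For
  -- `m = 0` the energy does not control `v` itself; `v` is recovered from its value at time `0` by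
  -- integrating `∂₀v` along the axis.
  have hdt : ∀ s ∈ Set.Ico 0 t, dirDeriv timeVec v (s, x₀) = 0 := fun s hs => by
    have hsR : s < R := hs.2.trans htR
    have hE : coneEnergy m R x₀ v s = 0 := le_antisymm
      ((hanti ⟨le_rfl, ht.trans htR.le⟩ ⟨hs.1, hsR.le⟩ hs.1).trans hE0.le)
      (coneEnergy_nonneg m R x₀ v s)
    have hc : Continuous fun p => coneWeight R x₀ p * energyDensity m v p :=
      (contDiff_coneWeight R x₀).continuous.mul (contDiff_energyDensity hv.1 m).continuous
    have hz := (integral_eq_zero_iff_of_nonneg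
      (fun x => mul_nonneg (expNegInvGlue.nonneg _) (energyDensity_nonneg m v (s, x)))
      ((spaceBounded_coneWeight_mul R x₀ (energyDensity m v)).integrable hc s)).1 hE
    have hz' := congrFun ((Continuous.ae_eq_iff_eq volume
      (hc.comp (Continuous.prodMk_right s)) continuous_const).1 hz) x₀
    have hpos : 0 < coneWeight R x₀ (s, x₀) := by
      refine expNegInvGlue.pos_of_pos ?_
      have : 0 < R - s := sub_pos.2 hsR
      simp only [coneFun, sub_self, norm_zero]
      nlinarith
    have he : energyDensity m v (s, x₀) = 0 := (mul_eq_zero.1 hz').resolve_left hpos.ne'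
    have hm := mul_nonneg (sq_nonneg m) (mul_self_nonneg (v (s, x₀)))
    have h := fun w => mul_self_nonneg (dirDeriv w v (s, x₀))
    rw [energyDensity] at he
    have := h timeVec
    have := h (spaceVec 0)
    have := h (spaceVec 1)
    have := h (spaceVec 2)
    exact mul_self_eq_zero.1 (le_antisymm (by linarith) (h timeVec))
  have hd := hasDerivAt_slice (hv.1.differentiable (by simp))
  have := constant_of_has_deriv_right_zero (f := fun s => v (s, x₀)) (a := 0) (b := t)
    (fun s _ => (hd s x₀).continuousAt.continuousWithinAt)
    (fun s hs => (((hd s x₀).congr_deriv (hdt s hs)).hasDerivWithinAt)) t ⟨ht, le_rfl⟩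
  rw [this]
  exact h0 x₀ (by simpa using ht.trans_lt htR)

/-! ### Spatial Fourier transform on time slices -/

/-- The spatial Fourier transform of `g` on the time slice `t`. -/
def sliceFourier (g : Minkowski → ℂ) (t : ℝ) (ξ : Space) : ℂ := ∫ y, planeWave (-y) ξ * g (t, y)

lemma sliceFourier_eq_fourier (g : Minkowski → ℂ) (t : ℝ) :
    sliceFourier g t = 𝓕 fun y => g (t, y) := by
  funext ξ
  rw [Real.fourier_eq']
  simp only [sliceFourier, planeWave, inner_neg_right, smul_eq_mul, real_inner_comm]
  congr 1
  funext y
  congr 3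
  push_cast
  ring

lemma integrable_planeWave_mul {g : Minkowski → ℂ} (hc : Continuous g) (hb : SpaceBounded g)
    (t : ℝ) (ξ : Space) : Integrable fun y => planeWave (-y) ξ * g (t, y) :=
  Continuous.integrable_of_hasCompactSupport (by fun_prop) (hb.hasCompactSupport t).mul_left

lemma contDiff_planeWave_neg (ξ : Space) : ContDiff ℝ ∞ fun p : Minkowski => planeWave (-p.2) ξ := by
  unfold planeWave
  have : ContDiff ℝ ∞ fun p : Minkowski => (2 * Real.pi * ⟪ξ, -p.2⟫ : ℝ) :=
    contDiff_const.mul (contDiff_const.inner ℝ contDiff_snd.neg)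
  exact ((Complex.ofRealCLM.contDiff.comp this).mul contDiff_const).cexp

lemma fderiv_planeWave_neg_mul {g : Minkowski → ℂ} (hg : ContDiff ℝ ∞ g) (ξ : Space)
    (p w : Minkowski) :
    fderiv ℝ (fun p : Minkowski => planeWave (-p.2) ξ * g p) p w =
      planeWave (-p.2) ξ * fderiv ℝ g p w -
        (∑ i, 2 * Real.pi * Complex.I * (ξ i : ℂ) * (w.2 i : ℂ)) * (planeWave (-p.2) ξ * g p) := by
  have h1 := hasFDerivAt_planeWave p (-ξ)
  simp only [planeWave_neg_right] at h1
  rw [(h1.fun_mul (hg.differentiable (by simp) p).hasFDerivAt).fderiv]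
  simp [spaceCoord, Fin.sum_univ_three]
  ring

lemma SpaceBounded.planeWave_mul {g : Minkowski → ℂ} (hb : SpaceBounded g) (ξ : Space) :
    SpaceBounded fun p : Minkowski => planeWave (-p.2) ξ * g p := hb.mul_left

lemma sliceFourier_spaceDeriv {g : Minkowski → ℂ} (hg : ContDiff ℝ ∞ g) (hb : SpaceBounded g)
    (t : ℝ) (i : Fin 3) (ξ : Space) :
    sliceFourier (spaceDeriv i g) t ξ = coordMul i (sliceFourier g t) ξ := by
  have h := (hb.planeWave_mul ξ).integral_fderiv_eq_zero
    (((contDiff_planeWave_neg ξ).mul hg).of_le (by simp)) t (EuclideanSpace.single i (1 : ℝ))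
  simp only [fderiv_planeWave_neg_mul hg] at h
  rw [integral_sub] at h
  · rw [coordMul, sliceFourier, sliceFourier, ← integral_const_mul]
    refine (sub_eq_zero.1 h).trans ?_
    congr 1
    funext y
    simp only [PiLp.single_apply]
    fin_cases i <;> simp [Fin.sum_univ_three]
  · exact integrable_planeWave_mul (continuous_spaceDeriv hg i) (hb.fderiv_apply _) t ξ
  · exact (integrable_planeWave_mul hg.continuous hb t ξ).const_mul _

lemma hasDerivAt_sliceFourier {g : Minkowski → ℂ} (hg : ContDiff ℝ ∞ g) (hb : SpaceBounded g)
    (t : ℝ) (ξ : Space) :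
    HasDerivAt (fun t => sliceFourier g t ξ) (sliceFourier (timeDeriv g) t ξ) t := by
  refine ((hb.planeWave_mul ξ).hasDerivAt_integral
    (((contDiff_planeWave_neg ξ).mul hg).of_le (by simp)) t).congr_deriv ?_
  simp only [fderiv_planeWave_neg_mul hg]
  simp [sliceFourier, timeDeriv]

lemma exists_norm_sliceFourier_le {g : Minkowski → ℂ} (hg : Continuous g) (hb : SpaceBounded g)
    (T : ℝ) : ∃ C, ∀ t ξ, |t| ≤ T → ‖sliceFourier g t ξ‖ ≤ C := by
  obtain ⟨R, hR⟩ := hb T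
  obtain ⟨M, hM⟩ := ((isCompact_closedBall (0 : ℝ) T).prod
    (isCompact_closedBall (0 : Space) R)).bddAbove_image hg.norm.continuousOn
  refine ⟨∫ x, (Metric.closedBall (0 : Space) R).indicator (fun _ => M) x, fun t ξ ht => ?_⟩
  refine norm_integral_le_of_norm_le ?_ (Eventually.of_forall fun y => ?_)
  · exact (integrable_indicator_iff Metric.isClosed_closedBall.measurableSet).2
      (integrableOn_const (isCompact_closedBall _ _).measure_ne_top)
  · rw [norm_mul, norm_planeWave, one_mul]
    by_cases hy : y ∈ Metric.closedBall (0 : Space) R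
    · rw [Set.indicator_of_mem hy]
      exact hM ⟨(t, y), ⟨by simpa using ht, hy⟩, rfl⟩
    · rw [Set.indicator_of_notMem hy, hR t y ht (by simpa using hy), norm_zero]

lemma exists_pow_mul_norm_sliceFourier_le {g : Minkowski → ℂ} (hg : ContDiff ℝ ∞ g)
    (hb : SpaceBounded g) (T : ℝ) (n : ℕ) :
    ∃ C, ∀ t ξ, |t| ≤ T → ‖ξ‖ ^ n * ‖sliceFourier g t ξ‖ ≤ C := by
  induction n generalizing g with
  | zero => simpa using exists_norm_sliceFourier_le hg.continuous hb T
  | succ n ih =>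
    choose C hC using fun i => ih (contDiff_spaceDeriv hg i) (hb.fderiv_apply _)
    refine ⟨∑ i, C i, fun t ξ ht => ?_⟩
    calc ‖ξ‖ ^ (n + 1) * ‖sliceFourier g t ξ‖
        = ‖ξ‖ ^ n * (‖ξ‖ * ‖sliceFourier g t ξ‖) := by ring
      _ ≤ ‖ξ‖ ^ n * ∑ i, ‖coordMul i (sliceFourier g t) ξ‖ :=
          mul_le_mul_of_nonneg_left (norm_mul_norm_le_sum_coordMul _ ξ) (by positivity)
      _ = ∑ i, ‖ξ‖ ^ n * ‖sliceFourier (spaceDeriv i g) t ξ‖ := by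
          rw [Finset.mul_sum]
          exact Finset.sum_congr rfl fun i _ => by rw [sliceFourier_spaceDeriv hg hb]
      _ ≤ ∑ i, C i := Finset.sum_le_sum fun i _ => hC i t ξ ht

lemma rapidDecay_sliceFourier {g : Minkowski → ℂ} (hg : ContDiff ℝ ∞ g) (hb : SpaceBounded g)
    (t : ℝ) : RapidDecay (sliceFourier g t) := by
  refine ⟨?_, fun n => ?_⟩
  · rw [sliceFourier_eq_fourier]
    exact VectorFourier.fourierIntegral_continuous Real.continuous_fourierChar
      continuous_inner (hb.integrable hg.continuous t)
  · obtain ⟨C, hC⟩ := exists_pow_mul_norm_sliceFourier_le hg hb |t| n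
    exact ⟨C, fun ξ => hC t ξ le_rfl⟩

lemma integral_planeWave_mul_sliceFourier {g : Minkowski → ℂ} (hg : ContDiff ℝ ∞ g)
    (hb : SpaceBounded g) (t : ℝ) (x : Space) :
    ∫ ξ, planeWave x ξ * sliceFourier g t ξ = g (t, x) := by
  have hi := (rapidDecay_sliceFourier hg hb t).integrable
  have hc : Continuous fun y => g (t, y) := by
    have := hg.continuous
    fun_prop
  rw [sliceFourier_eq_fourier] at hi ⊢
  have h := congrFun (hc.fourierInv_fourier_eq (hb.integrable hg.continuous t) hi) x
  rw [Real.fourierInv_eq'] at h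
  exact h

lemma stronglyMeasurable_sliceFourier {g : Minkowski → ℂ} (hg : Continuous g) :
    StronglyMeasurable fun p : Space × ℝ => sliceFourier g p.2 p.1 := by
  have h : Continuous fun q : (Space × ℝ) × Space => planeWave (-q.2) q.1.1 * g (q.1.2, q.2) := by
    fun_prop
  exact StronglyMeasurable.integral_prod_right' (f := fun q : (Space × ℝ) × Space =>
    planeWave (-q.2) q.1.1 * g (q.1.2, q.2)) h.stronglyMeasurable

lemma spaceBounded_of_hasCompactSupport {E : Type*} [NormedAddCommGroup E] {g : Minkowski → E}
    (hc : HasCompactSupport g) : SpaceBounded g := fun T => by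
  obtain ⟨R, hR⟩ := hc.isCompact.isBounded.exists_norm_le
  refine ⟨R, fun t x _ hx => image_eq_zero_of_notMem_tsupport fun h => ?_⟩
  exact absurd ((norm_snd_le ((t, x) : Minkowski)).trans (hR _ h)) (not_le.2 hx)

/-! ### `D * f` as a superposition of solutions with initial data on the slices of `f` -/

/-- Justifies exchanging the integrals over momentum and time: the slices of `f` are zero for `|s| >
T`, and for `|s| ≤ T` their transforms decay rapidly in `ξ`, uniformly in `s`. -/
lemma integrable_sinKernel_mul_sliceFourier {f : Minkowski → ℂ} (hf : ContDiff ℝ ∞ f)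
    (hc : HasCompactSupport f) (m : ℝ) (x : Minkowski) :
    Integrable (Function.uncurry fun (ξ : Space) (s : ℝ) =>
      planeWave x.2 ξ * ((sinKernel m (x.1 - s) ξ : ℂ) * sliceFourier f s ξ))
      ((volume : Measure Space).prod (volume : Measure ℝ)) := by
  obtain ⟨T, hT⟩ := hc.isCompact.isBounded.exists_norm_le
  have hb := spaceBounded_of_hasCompactSupport hc
  have hzero : ∀ s ξ, T < |s| → sliceFourier f s ξ = 0 := fun s ξ hs => by
    refine integral_eq_zero_of_ae (Eventually.of_forall fun y => ?_)
    have : f (s, y) = 0 := image_eq_zero_of_notMem_tsupport fun h =>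
      absurd ((norm_fst_le ((s, y) : Minkowski)).trans (hT _ h)) (not_le.2 hs)
    simp [this]
  set N := (volume : Measure Space).integrablePower with hN
  obtain ⟨C₁, h₁⟩ := exists_pow_mul_norm_sliceFourier_le hf hb T 0
  obtain ⟨C₂, h₂⟩ := exists_pow_mul_norm_sliceFourier_le hf hb T N
  have hbound : ∀ s ξ, |s| ≤ T → ‖sliceFourier f s ξ‖ ≤
      2 ^ N * (C₁ + C₂) * (1 + ‖ξ‖) ^ (-(N : ℝ)) := fun s ξ hs => by
    have := pow_mul_le_of_le_of_pow_mul_le (k := 0) (l := N) (norm_nonneg ξ)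
      (norm_nonneg (sliceFourier f s ξ)) (by simpa using h₁ s ξ hs) (by simpa using h₂ s ξ hs)
    simpa using this
  have hdom : Integrable (fun p : Space × ℝ => (2 ^ N * (C₁ + C₂) * (1 + ‖p.1‖) ^ (-(N : ℝ))) *
      (Metric.closedBall (0 : ℝ) T).indicator (fun _ => |x.1| + T) p.2)
      ((volume : Measure Space).prod (volume : Measure ℝ)) :=
    ((Measure.integrable_pow_neg_integrablePower (volume : Measure Space)).const_mul _).mul_prod
      ((integrable_indicator_iff Metric.isClosed_closedBall.measurableSet).2
        (integrableOn_const (isCompact_closedBall _ _).measure_ne_top))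
  refine hdom.mono' ?_ (Eventually.of_forall fun p => ?_)
  · have h1 : Continuous fun p : Space × ℝ => planeWave x.2 p.1 := by fun_prop
    have h2 : Continuous fun p : Space × ℝ => (sinKernel m (x.1 - p.2) p.1 : ℂ) := by fun_prop
    exact (h1.stronglyMeasurable.mul (h2.stronglyMeasurable.mul
      (stronglyMeasurable_sliceFourier hf.continuous))).aestronglyMeasurable
  · obtain ⟨ξ, s⟩ := p
    simp only [Function.uncurry, norm_mul, norm_planeWave, one_mul, Complex.norm_real,
      Real.norm_eq_abs]
    by_cases hs : |s| ≤ T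
    · rw [Set.indicator_of_mem (by simpa using hs), mul_comm]
      refine mul_le_mul (hbound s ξ hs) ((abs_sinKernel_le m _ ξ).trans ?_) (abs_nonneg _)
        ((norm_nonneg _).trans (hbound s ξ hs))
      exact (abs_sub _ _).trans (by linarith)
    · rw [hzero s ξ (not_le.1 hs), Set.indicator_of_notMem (by simpa using hs)]
      simp

lemma integral_sinKernel_sub_eq_integral_sliceFourier {f : Minkowski → ℂ} (hf : Continuous f)
    (hc : HasCompactSupport f) (m : ℝ) (x : Minkowski) (ξ : Space) :
    ∫ z, planeWave (x.2 - z.2) ξ * (sinKernel m (x.1 - z.1) ξ : ℂ) * f z =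
      planeWave x.2 ξ * ∫ s, (sinKernel m (x.1 - s) ξ : ℂ) * sliceFourier f s ξ := by
  have hi : Integrable (fun z : Minkowski =>
      planeWave (x.2 - z.2) ξ * (sinKernel m (x.1 - z.1) ξ : ℂ) * f z) :=
    Continuous.integrable_of_hasCompactSupport (by fun_prop) hc.mul_left
  rw [Measure.volume_eq_prod, integral_prod _ hi, ← integral_const_mul]
  congr 1
  funext s
  rw [sliceFourier, ← integral_const_mul, ← integral_const_mul]
  congr 1
  funext y
  rw [sub_eq_add_neg, planeWave_add]
  ring

/-- Duhamel's formula. The integrand is the solution whose value is `0` and whose velocity is `f(s,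
·)` at time `s`; in this form finite propagation speed applies slice by slice. -/
lemma pauliJordanConv_eq_integral_slices {f : Minkowski → ℝ} (hf : IsTestFunction f) (m : ℝ)
    (x : Minkowski) :
    pauliJordanConv m f x =
      ∫ s, modeSolution m (sliceFourier (fun z => (f z : ℂ)) s) 0 (x.1 - s, x.2) := by
  have hd := hf.contDiff_ofReal
  have hc := hf.hasCompactSupport_ofReal
  rw [pauliJordanConv_eq_modeSolution hf]
  change ∫ ξ, mode m _ _ x ξ = _
  simp only [← integral_sinKernel_sub_eq_mode hf,
    integral_sinKernel_sub_eq_integral_sliceFourier hd.continuous hc, ← integral_const_mul]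
  rw [integral_integral_swap (integrable_sinKernel_mul_sliceFourier hd hc m x)]
  simp [modeSolution, amplitude]

/-! ### Finite propagation speed for complex solutions -/

lemma dirDeriv_comp_clm {ζ : Minkowski → ℂ} (hζ : ContDiff ℝ ∞ ζ) (L : ℂ →L[ℝ] ℝ)
    (w p : Minkowski) : dirDeriv w (fun p => L (ζ p)) p = L (fderiv ℝ ζ p w) := by
  have h := L.hasFDerivAt.comp p (hζ.differentiable (by simp) p).hasFDerivAt
  rw [dirDeriv]
  change fderiv ℝ (L ∘ ζ) p w = _
  rw [h.fderiv]
  rfl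

lemma realKleinGordon_comp_clm {m : ℝ} {ζ : Minkowski → ℂ} (hζ : ContDiff ℝ ∞ ζ)
    (hKG : ∀ x, -box ζ x + (m : ℂ) ^ 2 * ζ x = 0) (L : ℂ →L[ℝ] ℝ) :
    RealKleinGordon m fun p => L (ζ p) := by
  refine ⟨L.contDiff.comp hζ, fun p => ?_⟩
  have hd : ∀ w, ContDiff ℝ ∞ fun p => fderiv ℝ ζ p w := fun w =>
    (hζ.fderiv_right (by simp)).clm_apply contDiff_const
  have h2 : ∀ w, dirDeriv w (dirDeriv w fun p => L (ζ p)) p =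
      L (fderiv ℝ (fun p => fderiv ℝ ζ p w) p w) := fun w => by
    rw [← dirDeriv_comp_clm (hd w) L]
    congr 1
    funext q
    exact dirDeriv_comp_clm hζ L w q
  simp only [h2]
  have h3 : fderiv ℝ (fun p => fderiv ℝ ζ p timeVec) p timeVec =
      ∑ i, fderiv ℝ (fun p => fderiv ℝ ζ p (spaceVec i)) p (spaceVec i) - (m ^ 2 : ℝ) • ζ p := by
    have h := hKG p
    rw [Complex.real_smul]
    push_cast
    change -(-fderiv ℝ (fun p => fderiv ℝ ζ p timeVec) p timeVec +
      ∑ i, fderiv ℝ (fun p => fderiv ℝ ζ p (spaceVec i)) p (spaceVec i)) + _ = 0 at h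
    linear_combination h
  rw [h3, map_sub, map_sum, map_smul, smul_eq_mul]

lemma kleinGordon_eq_zero_of_initial {m R : ℝ} {x₀ : Space} {ζ : Minkowski → ℂ}
    (hζ : ContDiff ℝ ∞ ζ) (hKG : ∀ x, -box ζ x + (m : ℂ) ^ 2 * ζ x = 0)
    (h0 : ∀ x, ‖x - x₀‖ < R → ζ (0, x) = 0)
    (h1 : ∀ x, ‖x - x₀‖ < R → timeDeriv ζ (0, x) = 0)
    {t : ℝ} (ht : 0 ≤ t) (htR : t < R) : ζ (t, x₀) = 0 := by
  have key : ∀ L : ℂ →L[ℝ] ℝ, L (ζ (t, x₀)) = 0 := fun L =>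
    (realKleinGordon_comp_clm hζ hKG L).eq_zero_of_initial
      (fun x hx => by rw [h0 x hx, map_zero])
      (fun x hx => by
        rw [dirDeriv_comp_clm hζ]
        change L (timeDeriv ζ (0, x)) = 0
        rw [h1 x hx, map_zero]) ht htR
  exact Complex.ext (key Complex.reCLM) (key Complex.imCLM)

lemma modeSolution_neg_time (m : ℝ) (A : Space → ℂ) (t : ℝ) (x : Space) :
    modeSolution m A 0 (-t, x) = -modeSolution m A 0 (t, x) := by
  simp [modeSolution, amplitude, sinKernel_neg_left, integral_neg]

/-- Fourier inversion identifies the initial velocity as `g(s, ·)`, so finite propagation covers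
nonnegative times; the solution is odd in time because its initial value is zero. -/
lemma modeSolution_sliceFourier_eq_zero {g : Minkowski → ℂ} (hg : ContDiff ℝ ∞ g)
    (hb : SpaceBounded g) (m : ℝ) {s t R : ℝ} {x₀ : Space}
    (h : ∀ x, ‖x - x₀‖ < R → g (s, x) = 0) (ht : |t| < R) :
    modeSolution m (sliceFourier g s) 0 (t, x₀) = 0 := by
  have hA := rapidDecay_sliceFourier hg hb s
  have key : modeSolution m (sliceFourier g s) 0 (|t|, x₀) = 0 := by
    refine kleinGordon_eq_zero_of_initial (contDiff_modeSolution hA RapidDecay.zero m)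
      (modeSolution_kleinGordon hA RapidDecay.zero m) (fun x _ => ?_) (fun x hx => ?_)
      (abs_nonneg t) ht
    · simp [modeSolution, amplitude, sinKernel_zero_left]
    · rw [timeDeriv_modeSolution hA RapidDecay.zero, ← h x hx,
        ← integral_planeWave_mul_sliceFourier hg hb s x]
      simp [modeSolution, amplitude, sinKernel_zero_left, cosKernel_zero_left]
  rcases abs_choice t with h' | h'
  · rwa [h'] at key
  · rwa [h', modeSolution_neg_time, neg_eq_zero] at key

/-! ### The support of `D * f` -/

/-- The closed double cone, including the origin. -/
def closedCone : Set Minkowski := {z | minkowskiSq z ≤ 0}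

lemma isClosed_closedCone : IsClosed closedCone := by
  unfold closedCone minkowskiSq
  exact isClosed_le (by fun_prop) continuous_const

lemma norm_snd_le_of_mem_closedCone {z : Minkowski} (hz : z ∈ closedCone) : ‖z.2‖ ≤ |z.1| := by
  refine abs_le_of_sq_le_sq' ?_ (abs_nonneg _) |>.2
  have : -z.1 ^ 2 + ‖z.2‖ ^ 2 ≤ 0 := hz
  rw [sq_abs]
  linarith

lemma mem_add_closedCone_of_ne_zero {f : Minkowski → ℝ} (hf : IsTestFunction f) {m : ℝ}
    {x : Minkowski} (hx : pauliJordanConv m f x ≠ 0) : x ∈ tsupport f + closedCone := by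
  by_contra hcon
  apply hx
  rw [pauliJordanConv_eq_integral_slices hf]
  refine integral_eq_zero_of_ae (Eventually.of_forall fun s => ?_)
  have hsub : Metric.closedBall x.2 |x.1 - s| ⊆ {y | (s, y) ∉ tsupport f} := fun y hy hys => by
    refine hcon ⟨(s, y), hys, x - (s, y), ?_, by simp⟩
    have h1 : ‖x.2 - y‖ ≤ |x.1 - s| := by simpa [dist_eq_norm, norm_sub_rev] using hy
    have h2 := pow_le_pow_left₀ (norm_nonneg _) h1 2
    rw [sq_abs] at h2
    simp only [closedCone, minkowskiSq, Set.mem_ofPred_eq, Prod.fst_sub, Prod.snd_sub]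
    linarith
  have hopen : IsOpen {y | (s, y) ∉ tsupport f} :=
    (isClosed_tsupport f).isOpen_compl.preimage (Continuous.prodMk_right s)
  -- Finite propagation needs a radius strictly larger than the elapsed time; compactness of the
  -- ball and closedness of the support provide the slack `δ`.
  obtain ⟨δ, hδ, hδs⟩ := (isCompact_closedBall x.2 |x.1 - s|).exists_thickening_subset_open
    hopen hsub
  rw [thickening_closedBall hδ (abs_nonneg _)] at hδs
  refine modeSolution_sliceFourier_eq_zero hf.contDiff_ofReal
    (spaceBounded_of_hasCompactSupport hf.hasCompactSupport_ofReal) m (R := δ + |x.1 - s|)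
    (fun y hy => ?_) (by linarith)
  have : (s, y) ∉ tsupport f := hδs (by simpa [dist_eq_norm] using hy)
  simp [image_eq_zero_of_notMem_tsupport this]

lemma tsupport_pauliJordanConv_subset {f : Minkowski → ℝ} (hf : IsTestFunction f) (m : ℝ) :
    tsupport (pauliJordanConv m f) ⊆ tsupport f + closedCone :=
  closure_minimal (fun _ hx => mem_add_closedCone_of_ne_zero hf hx)
    (isClosed_closedCone.add_left_of_isCompact hf.2.isCompact)

/-! ### Space-compactness and bounded spatial support -/

lemma isSpaceCompact_of_tsupport_subset {K : Set Minkowski} (hK : IsCompact K)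
    {ζ : Minkowski → ℂ} (h : tsupport ζ ⊆ K + closedCone) : IsSpaceCompact ζ := by
  -- The cone `J` omits the origin. Moving the base point one unit in time, away from the direction
  -- of `z`, makes the remaining vector causal and nonzero.
  refine ⟨K + {((1 : ℝ), (0 : Space)), ((-1 : ℝ), (0 : Space))}, hK.add (by simp), fun x hx => ?_⟩
  obtain ⟨k, hk, z, hz, rfl⟩ := h hx
  have hn := norm_snd_le_of_mem_closedCone hz
  have aux : ∀ c : ℝ, |z.1 - c| = |z.1| + 1 → z - (c, 0) ∈ causalCone := fun c hc => by
    have h1 : 0 ≤ |z.1| := abs_nonneg _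
    refine ⟨fun h0 => ?_, ?_⟩
    · have : z.1 - c = 0 := congrArg Prod.fst h0
      rw [this, abs_zero] at hc
      linarith
    · have h2 := pow_le_pow_left₀ (norm_nonneg _) (hn.trans (by linarith : |z.1| ≤ |z.1 - c|)) 2
      rw [sq_abs] at h2
      simp only [minkowskiSq, Prod.fst_sub, Prod.snd_sub, sub_zero]
      linarith
  rcases le_total 0 z.1 with h0 | h0
  · refine ⟨k + ((-1 : ℝ), (0 : Space)), ⟨k, hk, _, by simp, rfl⟩, z - ((-1 : ℝ), (0 : Space)),
      aux _ ?_, add_add_sub_cancel _ _ _⟩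
    rw [abs_of_nonneg h0, abs_of_nonneg (by linarith)]
    ring
  · refine ⟨k + ((1 : ℝ), (0 : Space)), ⟨k, hk, _, by simp, rfl⟩, z - ((1 : ℝ), (0 : Space)),
      aux _ ?_, add_add_sub_cancel _ _ _⟩
    rw [abs_of_nonpos h0, abs_of_nonpos (by linarith)]
    ring

lemma IsSpaceCompact.spaceBounded {ζ : Minkowski → ℂ} (h : IsSpaceCompact ζ) :
    SpaceBounded ζ := fun T => by
  obtain ⟨K, hK, hs⟩ := h
  obtain ⟨ρ, hρ⟩ := hK.isBounded.exists_norm_le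
  -- If `K` has radius `ρ`, a point `k + z` at time `|t| ≤ T` has `|z⁰| ≤ T + ρ`, hence `|z⃗| ≤ T +
  -- ρ`, and `|k⃗| ≤ ρ`.
  refine ⟨ρ + (T + ρ), fun t x ht hx => image_eq_zero_of_notMem_tsupport fun hmem => ?_⟩
  obtain ⟨k, hk, z, hz, hkz⟩ := hs hmem
  have h1 : k.1 + z.1 = t := congrArg Prod.fst hkz
  have h2 : k.2 + z.2 = x := congrArg Prod.snd hkz
  have hn := norm_snd_le_of_mem_closedCone (z := z) hz.2
  have hk1 : |k.1| ≤ ρ := (norm_fst_le k).trans (hρ k hk)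
  have hk2 : ‖k.2‖ ≤ ρ := (norm_snd_le k).trans (hρ k hk)
  have hz1 : |z.1| ≤ |t| + |k.1| := by
    rw [eq_sub_of_add_eq' h1]
    exact abs_sub _ _
  have := norm_add_le k.2 z.2
  rw [h2] at this
  linarith

lemma pauliJordanConv_mem_realSolutions {f : Minkowski → ℝ} (hf : IsTestFunction f) (m : ℝ) :
    pauliJordanConv m f ∈ realSolutions m := by
  have hA := hf.rapidDecay_velocityAmp m
  have hB := hf.rapidDecay_valueAmp m
  refine ⟨⟨?_, isSpaceCompact_of_tsupport_subset hf.2.isCompact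
    (tsupport_pauliJordanConv_subset hf m), ?_⟩, pauliJordanConv_im hf m⟩
  · rw [pauliJordanConv_eq_modeSolution hf]
    exact contDiff_modeSolution hA hB m
  · rw [pauliJordanConv_eq_modeSolution hf]
    exact modeSolution_kleinGordon hA hB m

/-! ### Every space-compact solution is of the form `D * f` -/

lemma timeDeriv_timeDeriv_of_kleinGordon {m : ℝ} {ζ : Minkowski → ℂ}
    (hKG : ∀ x, -box ζ x + (m : ℂ) ^ 2 * ζ x = 0) (x : Minkowski) :
    timeDeriv (timeDeriv ζ) x =
      ∑ i, spaceDeriv i (spaceDeriv i ζ) x - (m : ℂ) ^ 2 * ζ x := by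
  have h := hKG x
  rw [box] at h
  linear_combination h

lemma sliceFourier_timeDeriv_timeDeriv {m : ℝ} {ζ : Minkowski → ℂ} (hζ : ContDiff ℝ ∞ ζ)
    (hb : SpaceBounded ζ) (hKG : ∀ x, -box ζ x + (m : ℂ) ^ 2 * ζ x = 0) (t : ℝ) (ξ : Space) :
    sliceFourier (timeDeriv (timeDeriv ζ)) t ξ =
      -((freq m ξ : ℂ) ^ 2 * sliceFourier ζ t ξ) := by
  have hd := contDiff_spaceDeriv hζ
  have hsb : ∀ i, SpaceBounded (spaceDeriv i ζ) := fun i => hb.fderiv_apply _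
  have hi : ∀ i, Integrable fun y => planeWave (-y) ξ * spaceDeriv i (spaceDeriv i ζ) (t, y) :=
    fun i => integrable_planeWave_mul (continuous_spaceDeriv (hd i) i)
      ((hsb i).fderiv_apply _) t ξ
  have hs : ∀ i, ∫ y, planeWave (-y) ξ * spaceDeriv i (spaceDeriv i ζ) (t, y) =
      (2 * Real.pi * Complex.I * (ξ i : ℂ)) * ((2 * Real.pi * Complex.I * (ξ i : ℂ)) *
        sliceFourier ζ t ξ) := fun i => by
    have h1 := sliceFourier_spaceDeriv (hd i) (hsb i) t i ξ
    rw [coordMul, sliceFourier_spaceDeriv hζ hb t i ξ, coordMul] at h1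
    exact h1
  have hz := (integrable_planeWave_mul hζ.continuous hb t ξ).const_mul ((m : ℂ) ^ 2)
  have hpt : ∀ y, planeWave (-y) ξ * timeDeriv (timeDeriv ζ) (t, y) =
      ∑ i, planeWave (-y) ξ * spaceDeriv i (spaceDeriv i ζ) (t, y) -
        (m : ℂ) ^ 2 * (planeWave (-y) ξ * ζ (t, y)) := fun y => by
    rw [timeDeriv_timeDeriv_of_kleinGordon hKG, ← Finset.mul_sum]
    ring
  rw [sliceFourier]
  simp only [hpt]
  rw [integral_sub (integrable_finsetSum Finset.univ fun i _ => hi i) hz,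
    integral_finsetSum Finset.univ fun i _ => hi i, integral_const_mul]
  change _ - (m : ℂ) ^ 2 * sliceFourier ζ t ξ = _
  simp only [hs]
  have h2 : (freq m ξ : ℂ) ^ 2 =
      (2 * Real.pi) ^ 2 * ((ξ 0 : ℂ) ^ 2 + (ξ 1 : ℂ) ^ 2 + (ξ 2 : ℂ) ^ 2) + (m : ℂ) ^ 2 := by
    rw [← Complex.ofReal_pow, freq_sq, EuclideanSpace.norm_sq_eq, Fin.sum_univ_three]
    simp
  rw [h2, Fin.sum_univ_three]
  linear_combination (4 * Real.pi ^ 2 *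
    ((ξ 0 : ℂ) ^ 2 + (ξ 1 : ℂ) ^ 2 + (ξ 2 : ℂ) ^ 2) * sliceFourier ζ t ξ) * Complex.I_sq

/-! ### Variation of constants and the cut-off source -/

/-- Variation of constants for the oscillator equation `Z'' = -ε² Z`, with a cutoff `χ`. -/
lemma hasDerivAt_cutoff_oscillator (m t : ℝ) (ξ : Space) {Z Z' : ℝ → ℂ} {χ χ' χ'' : ℝ → ℝ}
    {s : ℝ} (hZ : HasDerivAt Z (Z' s) s)
    (hZ' : HasDerivAt Z' (-((freq m ξ : ℂ) ^ 2 * Z s)) s)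
    (hχ : HasDerivAt χ (χ' s) s) (hχ' : HasDerivAt χ' (χ'' s) s) :
    HasDerivAt (fun s => (sinKernel m (t - s) ξ : ℂ) * (χ' s * Z s + χ s * Z' s) +
        (cosKernel m (t - s) ξ : ℂ) * (χ s * Z s))
      ((sinKernel m (t - s) ξ : ℂ) * (χ'' s * Z s + 2 * χ' s * Z' s)) s := by
  have hS := ((hasDerivAt_sinKernel m (t - s) ξ).comp_const_sub t s).ofReal_comp
  have hC := ((hasDerivAt_cosKernel m (t - s) ξ).comp_const_sub t s).ofReal_comp
  have h := (hS.fun_mul ((hχ'.ofReal_comp.fun_mul hZ).fun_add (hχ.ofReal_comp.fun_mul hZ'))).fun_add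
    (hC.fun_mul (hχ.ofReal_comp.fun_mul hZ))
  refine h.congr_deriv ?_
  push_cast
  ring

/-- The left side is constant in `s` (the cutoff formula with `χ = 1`) and equals `Z t` at `s = t`.
-/
lemma oscillator_eq (m t s : ℝ) (ξ : Space) {Z Z' : ℝ → ℂ} (hZ : ∀ s, HasDerivAt Z (Z' s) s)
    (hZ' : ∀ s, HasDerivAt Z' (-((freq m ξ : ℂ) ^ 2 * Z s)) s) :
    (sinKernel m (t - s) ξ : ℂ) * Z' s + (cosKernel m (t - s) ξ : ℂ) * Z s = Z t := by
  have h : ∀ s, HasDerivAt (fun s => (sinKernel m (t - s) ξ : ℂ) * Z' s +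
      (cosKernel m (t - s) ξ : ℂ) * Z s) 0 s := fun s => by
    simpa using hasDerivAt_cutoff_oscillator m t ξ (hZ s) (hZ' s)
      (χ := fun _ => 1) (χ' := fun _ => 0) (χ'' := fun _ => 0)
      (hasDerivAt_const s 1) (hasDerivAt_const s 0)
  have := is_const_of_deriv_eq_zero (fun s => (h s).differentiableAt) (fun s => (h s).deriv) s t
  simpa [sinKernel_zero_left, cosKernel_zero_left] using this

lemma integral_cutoff_oscillator (m t : ℝ) (ξ : Space) {Z Z' : ℝ → ℂ} {χ χ' χ'' : ℝ → ℝ}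
    (hZ : ∀ s, HasDerivAt Z (Z' s) s)
    (hZ' : ∀ s, HasDerivAt Z' (-((freq m ξ : ℂ) ^ 2 * Z s)) s)
    (hχ : ∀ s, HasDerivAt χ (χ' s) s) (hχ' : ∀ s, HasDerivAt χ' (χ'' s) s)
    (h0 : ∀ s < 0, χ s = 0) (h1 : ∀ s, 1 < s → χ s = 1)
    (h0' : ∀ s < 0, χ' s = 0) (h1' : ∀ s, 1 < s → χ' s = 0)
    (hint : Integrable fun s => (sinKernel m (t - s) ξ : ℂ) * (χ'' s * Z s + 2 * χ' s * Z' s)) :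
    ∫ s, (sinKernel m (t - s) ξ : ℂ) * (χ'' s * Z s + 2 * χ' s * Z' s) = Z t := by
  -- The integrand is the derivative of an expression that is `0` for `s < 0`, where `χ` vanishes,
  -- and `Z t` for `s > 1`, where `χ = 1` and `oscillator_eq` applies.
  have key := integral_of_hasDerivAt_of_tendsto (m := (0 : ℂ)) (n := Z t)
    (fun s => hasDerivAt_cutoff_oscillator m t ξ (hZ s) (hZ' s) (hχ s) (hχ' s)) hint
    (tendsto_const_nhds.congr' ?_) (tendsto_const_nhds.congr' ?_)
  · simpa using key
  · filter_upwards [eventually_lt_atBot (0 : ℝ)] with s hs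
    simp [h0 s hs, h0' s hs]
  · filter_upwards [eventually_gt_atTop (1 : ℝ)] with s hs
    rw [← oscillator_eq m t s ξ hZ hZ']
    simp [h1 s hs, h1' s hs]

/-- The first derivative of the smooth time cutoff. -/
def cutoffDeriv : ℝ → ℝ := deriv Real.smoothTransition

lemma contDiff_cutoffDeriv : ContDiff ℝ ∞ cutoffDeriv :=
  ContDiff.iterate_deriv 1 (Real.smoothTransition.contDiff (n := ⊤))

lemma hasDerivAt_smoothTransition (s : ℝ) :
    HasDerivAt Real.smoothTransition (cutoffDeriv s) s :=
  ((Real.smoothTransition.contDiff (n := 1)).differentiable (by simp) s).hasDerivAt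

/-- The second derivative of the smooth time cutoff. -/
def cutoffDeriv₂ : ℝ → ℝ := deriv cutoffDeriv

lemma contDiff_cutoffDeriv₂ : ContDiff ℝ ∞ (cutoffDeriv₂) :=
  ContDiff.iterate_deriv 1 contDiff_cutoffDeriv

lemma hasDerivAt_cutoffDeriv (s : ℝ) : HasDerivAt cutoffDeriv (cutoffDeriv₂ s) s :=
  (contDiff_cutoffDeriv.differentiable (by simp) s).hasDerivAt

lemma cutoffDeriv_eq_zero {s : ℝ} (hs : s < 0 ∨ 1 < s) : cutoffDeriv s = 0 := by
  rcases hs with hs | hs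
  · have h : Real.smoothTransition =ᶠ[𝓝 s] fun _ => 0 := by
      filter_upwards [Iio_mem_nhds hs] with y hy using Real.smoothTransition.zero_of_nonpos hy.le
    rw [cutoffDeriv, h.deriv_eq, deriv_const]
  · have h : Real.smoothTransition =ᶠ[𝓝 s] fun _ => 1 := by
      filter_upwards [Ioi_mem_nhds hs] with y hy using Real.smoothTransition.one_of_one_le hy.le
    rw [cutoffDeriv, h.deriv_eq, deriv_const]

lemma cutoffDeriv₂_eq_zero {s : ℝ} (hs : s < 0 ∨ 1 < s) : cutoffDeriv₂ s = 0 := by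
  have h : cutoffDeriv =ᶠ[𝓝 s] fun _ => 0 := by
    rcases hs with hs | hs
    · filter_upwards [Iio_mem_nhds hs] with y hy using cutoffDeriv_eq_zero (Or.inl hy)
    · filter_upwards [Ioi_mem_nhds hs] with y hy using cutoffDeriv_eq_zero (Or.inr hy)
  rw [cutoffDeriv₂, h.deriv_eq, deriv_const]

/-- The source `(-□ + m²)(χ ζ) = χ'' ζ + 2 χ' ∂₀ζ` of a solution `ζ` cut off in time by `χ`. -/
def cutoffSource (ζ : Minkowski → ℂ) (p : Minkowski) : ℂ :=
  (cutoffDeriv₂ p.1 : ℂ) * ζ p + 2 * (cutoffDeriv p.1 : ℂ) * timeDeriv ζ p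

lemma contDiff_cutoffSource {ζ : Minkowski → ℂ} (hζ : ContDiff ℝ ∞ ζ) :
    ContDiff ℝ ∞ (cutoffSource ζ) := by
  have h1 : ContDiff ℝ ∞ fun p : Minkowski => (cutoffDeriv p.1 : ℂ) :=
    Complex.ofRealCLM.contDiff.comp (contDiff_cutoffDeriv.comp contDiff_fst)
  have h2 : ContDiff ℝ ∞ fun p : Minkowski => (cutoffDeriv₂ p.1 : ℂ) :=
    Complex.ofRealCLM.contDiff.comp (contDiff_cutoffDeriv₂.comp contDiff_fst)
  exact (h2.mul hζ).add ((contDiff_const.mul h1).mul (contDiff_timeDeriv hζ))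

lemma hasCompactSupport_cutoffSource {ζ : Minkowski → ℂ} (hb : SpaceBounded ζ) :
    HasCompactSupport (cutoffSource ζ) := by
  obtain ⟨R₁, hR₁⟩ := hb 1
  obtain ⟨R₂, hR₂⟩ := (hb.fderiv_apply ((1 : ℝ), (0 : Space))) 1
  refine HasCompactSupport.intro ((isCompact_Icc (a := (0 : ℝ)) (b := 1)).prod
    (isCompact_closedBall (0 : Space) (max R₁ R₂))) fun p hp => ?_
  obtain ⟨t, x⟩ := p
  by_cases ht : t < 0 ∨ 1 < t
  · simp [cutoffSource, cutoffDeriv_eq_zero ht, cutoffDeriv₂_eq_zero ht]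
  · push Not at ht
    have hx : max R₁ R₂ < ‖x‖ := by
      by_contra hx
      exact hp ⟨ht, mem_closedBall_zero_iff.2 (not_lt.1 hx)⟩
    have ht' : |t| ≤ 1 := (abs_of_nonneg ht.1).trans_le ht.2
    have h1 := hR₁ t x ht' ((le_max_left _ _).trans_lt hx)
    have h2 : timeDeriv ζ (t, x) = 0 := hR₂ t x ht' ((le_max_right _ _).trans_lt hx)
    simp [cutoffSource, h1, h2]

lemma timeDeriv_im_eq_zero {ζ : Minkowski → ℂ} (hζ : ContDiff ℝ ∞ ζ) (him : ∀ x, (ζ x).im = 0)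
    (p : Minkowski) : (timeDeriv ζ p).im = 0 := by
  have h := dirDeriv_comp_clm hζ Complex.imCLM timeVec p
  have h0 : (fun p => Complex.imCLM (ζ p)) = fun _ => 0 := funext him
  rw [h0] at h
  change _ = (timeDeriv ζ p).im at h
  rw [← h]
  simp [dirDeriv]

lemma sliceFourier_cutoffSource {ζ : Minkowski → ℂ} (hζ : ContDiff ℝ ∞ ζ) (hb : SpaceBounded ζ)
    (t : ℝ) (ξ : Space) :
    sliceFourier (cutoffSource ζ) t ξ = (cutoffDeriv₂ t : ℂ) * sliceFourier ζ t ξ +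
      2 * (cutoffDeriv t : ℂ) * sliceFourier (timeDeriv ζ) t ξ := by
  have h1 := integrable_planeWave_mul hζ.continuous hb t ξ
  have h2 := integrable_planeWave_mul (contDiff_timeDeriv hζ).continuous
    (hb.fderiv_apply ((1 : ℝ), (0 : Space))) t ξ
  simp only [sliceFourier]
  rw [← integral_const_mul, ← integral_const_mul,
    ← integral_add (h1.const_mul _) (Integrable.const_mul h2 _)]
  congr 1
  funext y
  rw [cutoffSource]
  ring

lemma exists_pauliJordanConv_eq {m : ℝ} {ζ : Minkowski → ℂ} (h : ζ ∈ realSolutions m) :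
    ∃ f : Minkowski → ℝ, IsTestFunction f ∧ pauliJordanConv m f = ζ := by
  obtain ⟨⟨hζ, hsc, hKG⟩, him⟩ := h
  have hb := hsc.spaceBounded
  have hcd := contDiff_cutoffSource hζ
  have hcs := hasCompactSupport_cutoffSource hb
  have hf : IsTestFunction fun p => (cutoffSource ζ p).re :=
    ⟨Complex.reCLM.contDiff.comp hcd, hcs.comp_left (g := Complex.re) Complex.zero_re⟩
  have hre : ∀ p, ((cutoffSource ζ p).re : ℂ) = cutoffSource ζ p := fun p => by
    refine Complex.ext (Complex.ofReal_re _) ?_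
    simp [cutoffSource, him, timeDeriv_im_eq_zero hζ him]
  refine ⟨_, hf, ?_⟩
  funext x
  rw [pauliJordanConv_eq_modeSolution hf, ← integral_planeWave_mul_sliceFourier hζ hb x.1 x.2]
  change ∫ ξ, mode m _ _ x ξ = _
  -- It suffices to compare the spatial Fourier transforms for each `ξ`; there the claim is the
  -- scalar variation-of-constants formula.
  congr 1
  funext ξ
  rw [← integral_sinKernel_sub_eq_mode hf]
  simp only [hre]
  rw [integral_sinKernel_sub_eq_integral_sliceFourier hcd.continuous hcs]
  congr 1
  have hb' : SpaceBounded (timeDeriv ζ) := hb.fderiv_apply _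
  have hint : Integrable fun s =>
      (sinKernel m (x.1 - s) ξ : ℂ) * sliceFourier (cutoffSource ζ) s ξ := by
    have hcont : Continuous fun s => sliceFourier (cutoffSource ζ) s ξ :=
      continuous_iff_continuousAt.2 fun s =>
        (hasDerivAt_sliceFourier hcd (spaceBounded_of_hasCompactSupport hcs) s ξ).continuousAt
    have hsupp : HasCompactSupport fun s => sliceFourier (cutoffSource ζ) s ξ := by
      refine HasCompactSupport.intro (isCompact_Icc (a := (0 : ℝ)) (b := 1)) fun s hs => ?_
      have hs' : s < 0 ∨ 1 < s := by
        by_contra hcon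
        push Not at hcon
        exact hs hcon
      rw [sliceFourier_cutoffSource hζ hb, cutoffDeriv_eq_zero hs', cutoffDeriv₂_eq_zero hs']
      simp
    exact Continuous.integrable_of_hasCompactSupport (by fun_prop) hsupp.mul_left
  simp only [sliceFourier_cutoffSource hζ hb] at hint ⊢
  exact integral_cutoff_oscillator m x.1 ξ (Z := fun s => sliceFourier ζ s ξ)
    (Z' := fun s => sliceFourier (timeDeriv ζ) s ξ) (χ := Real.smoothTransition)
    (χ' := cutoffDeriv) (χ'' := cutoffDeriv₂)
    (fun s => hasDerivAt_sliceFourier hζ hb s ξ)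
    (fun s => (hasDerivAt_sliceFourier (contDiff_timeDeriv hζ) hb' s ξ).congr_deriv
      (sliceFourier_timeDeriv_timeDeriv hζ hb hKG s ξ))
    hasDerivAt_smoothTransition hasDerivAt_cutoffDeriv
    (fun s hs => Real.smoothTransition.zero_of_nonpos hs.le)
    (fun s hs => Real.smoothTransition.one_of_one_le hs.le)
    (fun s hs => cutoffDeriv_eq_zero (Or.inl hs)) (fun s hs => cutoffDeriv_eq_zero (Or.inr hs))
    hint

/-! ### The symplectic form in momentum space -/

lemma integral_inverse_mul_eq {a g : Space → ℂ} (ha : Integrable a) (hg : Integrable g) :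
    ∫ x, (∫ ξ, planeWave x ξ * a ξ) * g x = ∫ ξ, a ξ * ∫ x, planeWave x ξ * g x := by
  have hprod : Integrable (Function.uncurry fun x ξ => planeWave x ξ * a ξ * g x)
      ((volume : Measure Space).prod (volume : Measure Space)) := by
    have h := hg.mul_prod ha
    refine (h.bdd_mul (c := 1) (f := fun p : Space × Space => planeWave p.1 p.2)
      (by fun_prop) (Eventually.of_forall fun p => (norm_planeWave _ _).le)).congr
      (Eventually.of_forall fun p => ?_)
    simp only [Function.uncurry]
    ring
  simp only [← integral_mul_const]
  rw [integral_integral_swap hprod]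
  congr 1
  funext ξ
  rw [← integral_const_mul]
  congr 1
  funext x
  ring

/-- Fourier inversion on a slice; the plane wave without a minus sign accounts for `-ξ`. Bounded
spatial support supplies the integrability that inversion needs. -/
lemma integral_planeWave_mul_modeSolution {A B : Space → ℂ} (hA : RapidDecay A)
    (hB : RapidDecay B) {m : ℝ} (hb : SpaceBounded (modeSolution m A B)) (t : ℝ) (ξ : Space) :
    ∫ x, planeWave x ξ * modeSolution m A B (t, x) = amplitude m A B t (-ξ) := by
  have ha := hA.amplitude hB m t
  have hs : (fun x => modeSolution m A B (t, x)) = 𝓕⁻ (amplitude m A B t) :=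
    funext fun x => modeSolution_eq_fourierInv m A B (t, x)
  have hi : Integrable (𝓕⁻ (amplitude m A B t)) :=
    hs ▸ hb.integrable (contDiff_modeSolution hA hB m).continuous t
  have hi' : Integrable (𝓕 (amplitude m A B t)) := by
    refine hi.comp_neg.congr (Eventually.of_forall fun x => ?_)
    simp [Real.fourierInv_eq_fourier_neg]
  rw [← congrFun (ha.continuous.fourier_fourierInv_eq ha.integrable hi') (-ξ), ← hs,
    ← sliceFourier_eq_fourier]
  simp [sliceFourier, planeWave_neg_right]

lemma integral_modeSolution_mul {A₁ B₁ A₂ B₂ : Space → ℂ} (hA₁ : RapidDecay A₁)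
    (hB₁ : RapidDecay B₁) (hA₂ : RapidDecay A₂) (hB₂ : RapidDecay B₂) {m : ℝ}
    (hb : SpaceBounded (modeSolution m A₂ B₂)) (t : ℝ) :
    ∫ x, modeSolution m A₁ B₁ (t, x) * modeSolution m A₂ B₂ (t, x) =
      ∫ ξ, amplitude m A₁ B₁ t ξ * amplitude m A₂ B₂ t (-ξ) := by
  have h := integral_inverse_mul_eq (hA₁.amplitude hB₁ m t).integrable
    (hb.integrable (contDiff_modeSolution hA₂ hB₂ m).continuous t)
  simp only [integral_planeWave_mul_modeSolution hA₂ hB₂ hb] at h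
  exact h

lemma RapidDecay.comp_neg {a : Space → ℂ} (ha : RapidDecay a) : RapidDecay fun ξ => a (-ξ) :=
  ⟨ha.1.comp continuous_neg, fun n => by
    obtain ⟨C, hC⟩ := ha.2 n
    exact ⟨C, fun ξ => by simpa using hC (-ξ)⟩⟩

lemma RapidDecay.integrable_mul {a b : Space → ℂ} (ha : RapidDecay a) (hb : RapidDecay b) :
    Integrable fun ξ => a ξ * b ξ := by
  obtain ⟨C, hC⟩ := ha.2 0
  exact (hb.mul_bounded ha.1 (C := C) fun ξ => by simpa using hC ξ).integrable

lemma symplecticForm_modeSolution {A₁ B₁ A₂ B₂ : Space → ℂ} (hA₁ : RapidDecay A₁)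
    (hB₁ : RapidDecay B₁) (hA₂ : RapidDecay A₂) (hB₂ : RapidDecay B₂) {m : ℝ}
    (hb : SpaceBounded (modeSolution m A₂ B₂)) (t : ℝ) :
    -symplecticForm t (modeSolution m A₁ B₁) (modeSolution m A₂ B₂) =
      ∫ ξ, (A₁ ξ * B₂ (-ξ) - B₁ ξ * A₂ (-ξ)) := by
  have hC₁ := hB₁.negFreqSqMul m
  have hC₂ := hB₂.negFreqSqMul m
  have hb' : SpaceBounded (modeSolution m (negFreqSqMul m B₂) A₂) := by
    rw [← timeDeriv_modeSolution hA₂ hB₂]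
    exact hb.fderiv_apply _
  have hc₁ := (contDiff_modeSolution hA₁ hB₁ m).continuous
  have hc₁' := (contDiff_modeSolution hC₁ hA₁ m).continuous
  have hc₂ := (contDiff_modeSolution hA₂ hB₂ m).continuous
  have hc₂' := (contDiff_modeSolution hC₂ hA₂ m).continuous
  have hi₁ : Integrable fun x =>
      modeSolution m (negFreqSqMul m B₁) A₁ (t, x) * modeSolution m A₂ B₂ (t, x) :=
    hb.mul_left.integrable (hc₁'.mul hc₂) t
  have hi₂ : Integrable fun x =>
      modeSolution m A₁ B₁ (t, x) * modeSolution m (negFreqSqMul m B₂) A₂ (t, x) :=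
    hb'.mul_left.integrable (hc₁.mul hc₂') t
  have hsplit : -symplecticForm t (modeSolution m A₁ B₁) (modeSolution m A₂ B₂) =
      (∫ x, modeSolution m (negFreqSqMul m B₁) A₁ (t, x) * modeSolution m A₂ B₂ (t, x)) -
        ∫ x, modeSolution m A₁ B₁ (t, x) * modeSolution m (negFreqSqMul m B₂) A₂ (t, x) := by
    rw [symplecticForm, timeDeriv_modeSolution hA₁ hB₁, timeDeriv_modeSolution hA₂ hB₂,
      ← integral_sub hi₁ hi₂, ← integral_neg]
    congr 1
    funext x
    ring
  rw [hsplit, integral_modeSolution_mul hC₁ hA₁ hA₂ hB₂ hb,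
    integral_modeSolution_mul hA₁ hB₁ hC₂ hA₂ hb', ← integral_sub]
  · congr 1
    funext ξ
    have h : (cosKernel m t ξ : ℂ) ^ 2 + (freq m ξ : ℂ) ^ 2 * (sinKernel m t ξ : ℂ) ^ 2 = 1 :=
      mod_cast cosKernel_sq_add m t ξ
    simp only [amplitude, negFreqSqMul, sinKernel_neg_right, cosKernel_neg_right, freq_neg]
    -- The `A₁A₂` and `B₁B₂` terms cancel, and the mixed terms carry the factor `C² + ε² S² = 1`,
    -- which removes `t`.
    linear_combination (A₁ ξ * B₂ (-ξ) - B₁ ξ * A₂ (-ξ)) * h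
  · exact (hC₁.amplitude hA₁ m t).integrable_mul (hA₂.amplitude hB₂ m t).comp_neg
  · exact (hA₁.amplitude hB₁ m t).integrable_mul (hC₂.amplitude hA₂ m t).comp_neg

/-! ### Pairing a test function with a mode solution -/

lemma integrable_test_mul_mode {f : Minkowski → ℂ} (hf : Continuous f) (hc : HasCompactSupport f)
    {A B : Space → ℂ} (hA : RapidDecay A) (hB : RapidDecay B) (m : ℝ) :
    Integrable (Function.uncurry fun z ξ => f z * mode m A B z ξ)
      ((volume : Measure Minkowski).prod (volume : Measure Space)) := by
  have h1 : Integrable fun z : Minkowski => ‖f z‖ * |z.1| :=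
    Continuous.integrable_of_hasCompactSupport (by fun_prop) hc.norm.mul_right
  have h2 : Integrable fun z : Minkowski => ‖f z‖ :=
    Continuous.integrable_of_hasCompactSupport (by fun_prop) hc.norm
  have hdom := (h1.mul_prod hA.integrable.norm).add (h2.mul_prod hB.integrable.norm)
  refine hdom.mono' ?_ (Eventually.of_forall fun p => ?_)
  · have hAc := hA.continuous
    have hBc := hB.continuous
    have : Continuous (Function.uncurry fun z ξ => f z * mode m A B z ξ) := by
      unfold mode amplitude
      fun_prop
    exact this.aestronglyMeasurable
  · simp only [Function.uncurry, norm_mul, Pi.add_apply]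
    refine (mul_le_mul_of_nonneg_left (norm_mode_le m A B p.1 p.2) (norm_nonneg _)).trans
      (le_of_eq ?_)
    ring

lemma integral_test_mul_mode {f : Minkowski → ℂ} (hf : Continuous f) (hc : HasCompactSupport f)
    (m : ℝ) (A B : Space → ℂ) (ξ : Space) :
    ∫ z, f z * mode m A B z ξ =
      modeTransform m 1 0 f (-ξ) * A ξ + modeTransform m 0 1 f (-ξ) * B ξ := by
  simp only [modeTransform, neg_neg]
  rw [← integral_mul_const, ← integral_mul_const,
    ← integral_add ((integrable_mode_mul m 1 0 hf hc ξ).mul_const _)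
      ((integrable_mode_mul m 0 1 hf hc ξ).mul_const _)]
  congr 1
  funext z
  simp only [mode, amplitude]
  ring

lemma neg_symplecticForm_pauliJordanConv {f₁ f₂ : Minkowski → ℝ} (hf₁ : IsTestFunction f₁)
    (hf₂ : IsTestFunction f₂) (m t : ℝ) :
    -symplecticForm t (pauliJordanConv m f₁) (pauliJordanConv m f₂) =
      ∫ x, (f₁ x : ℂ) * pauliJordanConv m f₂ x := by
  have hA₁ := hf₁.rapidDecay_velocityAmp m
  have hB₁ := hf₁.rapidDecay_valueAmp m
  have hA₂ := hf₂.rapidDecay_velocityAmp m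
  have hB₂ := hf₂.rapidDecay_valueAmp m
  have hb := (pauliJordanConv_mem_realSolutions hf₂ m).1.2.1.spaceBounded
  have hc := hf₁.contDiff_ofReal.continuous
  have hs := hf₁.hasCompactSupport_ofReal
  rw [pauliJordanConv_eq_modeSolution hf₂] at hb
  rw [pauliJordanConv_eq_modeSolution hf₁, pauliJordanConv_eq_modeSolution hf₂,
    symplecticForm_modeSolution hA₁ hB₁ hA₂ hB₂ hb t]
  change _ = ∫ x, (f₁ x : ℂ) * ∫ ξ, mode m _ _ x ξ
  simp only [← integral_const_mul]
  -- After Fubini the transforms of `f₁` appear at `-ξ`, whereas the symplectic side has `f₁` at `ξ`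
  -- and `f₂` at `-ξ`; the reflection `ξ ↦ -ξ` of the left integral aligns them.
  rw [integral_integral_swap (integrable_test_mul_mode hc hs hA₂ hB₂ m),
    ← integral_neg_eq_self]
  congr 1
  funext ξ
  rw [integral_test_mul_mode hc hs]
  simp only [velocityAmp, valueAmp, neg_neg]
  ring

/-! ### Locality -/

lemma test_mul_pauliJordanConv_eq_zero {f₁ f₂ : Minkowski → ℝ} (hf₁ : IsTestFunction f₁)
    (hf₂ : IsTestFunction f₂) (h : SpatiallySeparated (tsupport f₁) (tsupport f₂)) (m : ℝ)
    (x : Minkowski) : (f₁ x : ℂ) * pauliJordanConv m f₂ x = 0 := by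
  by_contra hne
  obtain ⟨h1, h2⟩ := mul_ne_zero_iff.1 hne
  have h1' : f₁ x ≠ 0 := Complex.ofReal_ne_zero.1 h1
  obtain ⟨y, hy, z, hz, rfl⟩ := mem_add_closedCone_of_ne_zero hf₂ h2
  refine Set.eq_empty_iff_forall_notMem.1 h y ⟨?_, hy⟩
  -- The vector `0` is not in `J`. In that case `f₁` is still nonzero slightly earlier in time, and
  -- the small time step is a nonzero causal vector.
  by_cases hz0 : z = 0
  · subst hz0
    have hcont : Continuous fun δ : ℝ => f₁ (y - (δ, 0)) := by
      have := hf₁.1.continuous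
      fun_prop
    have hev : ∀ᶠ δ : ℝ in 𝓝[>] 0, f₁ (y - (δ, 0)) ≠ 0 := by
      refine nhdsWithin_le_nhds (hcont.continuousAt.eventually_ne ?_)
      have : y - ((0 : ℝ), (0 : Space)) = y + 0 := by
        rw [Prod.mk_zero_zero, sub_zero, add_zero]
      rw [this]
      exact h1'
    obtain ⟨δ, hδ, hδ0⟩ := (hev.and self_mem_nhdsWithin).exists
    refine ⟨y - (δ, 0), subset_tsupport _ hδ, (δ, 0), ⟨fun h0 => ?_, ?_⟩, sub_add_cancel _ _⟩
    · exact (ne_of_gt hδ0) (congrArg Prod.fst h0)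
    · simp only [minkowskiSq, norm_zero]
      nlinarith [sq_nonneg δ]
  · refine ⟨y + z, subset_tsupport _ h1', -z, ⟨neg_ne_zero.2 hz0, ?_⟩, add_neg_cancel_right _ _⟩
    simpa [minkowskiSq, closedCone] using hz

end KleinGordon

end

/-! ### The theorem -/

theorem mainTheorem10 (m : ℝ) (hm : 0 ≤ m) :
    (∀ f : KleinGordon.Minkowski → ℝ, KleinGordon.IsTestFunction f →
      (∀ x : KleinGordon.Minkowski,
        Integrable (KleinGordon.pauliJordanMode m (fun z => (f (x - z) : ℂ)))) ∧
      KleinGordon.pauliJordanConv m f ∈ KleinGordon.realSolutions m) ∧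
    (∀ ζ ∈ KleinGordon.realSolutions m,
      ∃ f : KleinGordon.Minkowski → ℝ, KleinGordon.IsTestFunction f ∧
        KleinGordon.pauliJordanConv m f = ζ) ∧
    (∀ f₁ f₂ : KleinGordon.Minkowski → ℝ,
      KleinGordon.IsTestFunction f₁ → KleinGordon.IsTestFunction f₂ → ∀ t : ℝ,
        -KleinGordon.symplecticForm t
            (KleinGordon.pauliJordanConv m f₁) (KleinGordon.pauliJordanConv m f₂) =
          ∫ x : KleinGordon.Minkowski, (f₁ x : ℂ) * KleinGordon.pauliJordanConv m f₂ x) ∧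
    (∀ f₁ f₂ : KleinGordon.Minkowski → ℝ,
      KleinGordon.IsTestFunction f₁ → KleinGordon.IsTestFunction f₂ →
      KleinGordon.SpatiallySeparated (tsupport f₁) (tsupport f₂) → ∀ t : ℝ,
        KleinGordon.symplecticForm t
          (KleinGordon.pauliJordanConv m f₁) (KleinGordon.pauliJordanConv m f₂) = 0) := by
  refine ⟨fun f hf => ⟨fun x => KleinGordon.integrable_pauliJordanMode hf m x,
      KleinGordon.pauliJordanConv_mem_realSolutions hf m⟩,
    fun ζ hζ => KleinGordon.exists_pauliJordanConv_eq hζ,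
    fun f₁ f₂ hf₁ hf₂ t => KleinGordon.neg_symplecticForm_pauliJordanConv hf₁ hf₂ m t,
    fun f₁ f₂ hf₁ hf₂ h t => ?_⟩
  rw [← neg_eq_zero, KleinGordon.neg_symplecticForm_pauliJordanConv hf₁ hf₂ m t]
  simp only [KleinGordon.test_mul_pauliJordanConv_eq_zero hf₁ hf₂ h m, integral_zero]
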